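/- Theorem 1 (dyadic uncertainty principle). For $x\in\mathbb{R}_+=[0,\infty)$ let $x=\sum_{j\in\mathbb{Z}}x_j2^{-j-1}$, $x_j\in\{0,1\}$, be its binary expansion (the one with $x_j\to 0$ as $j\to\infty$ if there are two). Put $x\oplus y=\sum_{j\in\mathbb{Z}}|x_j-y_j|2^{-j-1}$ and $w(t,x)=(-1)^{\sum_{j\in\mathbb{Z}}t_jx_{-j-1}}$. For $f\in L_2(\mathbb{R}_+)$ (complex valued) the Walsh–Fourier transform $\widehat f\in L_2(\mathbb{R}_+)$ is the limit in $L_2(\mathbb{R}_+)$, as $n\to\infty$, of the functions $t\mapsto\int_0^n f(x)w(t,x)\,dx$; this limit exists. For $f\neq 0$ let $$V(f)=\frac{1}{\|f\|_2^2}\inf_{\tilde x\in\mathbb{R}_+}\int_{\mathbb{R}_+}(x\oplus\tilde x)^2|f(x)|^2\,dx\in[0,\infty],\qquad UC_d(f)=V(f)\,V(\widehat f).$$ Then for every $f\in L_2(\mathbb{R}_+)$, $f\neq 0$, and every $0<\theta<1/2$, $$UC_d(f)\ \ge\ C(\theta)^2,\qquad C(\theta)=(2K_1(\theta))^{-1/\theta},\qquad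 K_1(\theta)=(2\theta)^{-2\theta}(1-2\theta)^{\theta-1},$$ and $$UC_d(f)\ \ge\ 8.5\times10^{-5}.$$ -/

import Mathlib

open MeasureTheory Filter Topology Set
open scoped NNReal ENNReal

noncomputable section

namespace DyadicUncertainty

/-- Lebesgue measure on `ℝ₊ = [0, ∞)`. -/
def lebesgue : Measure ℝ≥0 := (volume : Measure ℝ).comap ((↑) : ℝ≥0 → ℝ)

/-- The space `L₂(ℝ₊)` of complex valued square integrable functions. -/
abbrev L2 : Type := Lp ℂ 2 lebesgue

/-- The binary digit `x_j` (`j ∈ ℤ`) of `x = ∑_j x_j 2^{-j-1} ≥ 0`; at dyadic rationals the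
expansion that ends in zeros is chosen. -/
def digit (x : ℝ≥0) (j : ℤ) : ℕ := ⌊(2 : ℝ≥0) ^ (j + 1) * x⌋₊ % 2

/-- The dyadic sum `x ⊕ y = ∑_j |x_j - y_j| 2^{-j-1}`; it is also the dyadic distance. -/
def dyadicAdd (x y : ℝ≥0) : ℝ≥0 :=
  ∑' j : ℤ, (((digit x j : ℤ) - (digit y j : ℤ)).natAbs : ℝ≥0) * (2 : ℝ≥0) ^ (-j - 1)

/-- The Walsh kernel `w(t, x) = (-1)^{∑_j t_j x_{-j-1}}`. Only finitely many terms of the sum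
are non-zero. -/
def walsh (t x : ℝ≥0) : ℝ := (-1) ^ (∑ᶠ j : ℤ, digit t j * digit x (-j - 1))

/-- The Walsh-Fourier transform `∫ f(x) w(t, x) dx` of an integrable `f : ℝ₊ → ℂ`. -/
def walshFourier (f : ℝ≥0 → ℂ) (t : ℝ≥0) : ℂ := ∫ x : ℝ≥0, f x * (walsh t x : ℂ) ∂lebesgue

/-- `g` is the Walsh-Fourier transform of `f ∈ L₂(ℝ₊)`: the transforms of the truncations of `f`
to `[0, n)`, which are in `L₁ ∩ L₂`, converge to `g` in `L₂`. -/
def IsWalshFourierL2 (f g : L2) : Prop :=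
  Tendsto (fun n : ℕ => eLpNorm
    (fun t => walshFourier ((Iio (n : ℝ≥0)).indicator f) t - g t) 2 lebesgue) atTop (𝓝 0)

/-- The Walsh-Fourier transform on `L₂(ℝ₊)`: the unique `g` with `IsWalshFourierL2 f g`. -/
def walshFourierL2 (f : L2) : L2 :=
  Classical.epsilon fun g => IsWalshFourierL2 f g

/-- `V(f) = ‖f‖⁻² inf_y ∫ (x ⊕ y)² |f(x)|² dx`, with values in `[0, ∞]`. -/
def dyadicV (f : L2) : ℝ≥0∞ :=
  (⨅ y : ℝ≥0, ∫⁻ x : ℝ≥0, (dyadicAdd x y : ℝ≥0∞) ^ 2 * ‖f x‖ₑ ^ 2 ∂lebesgue) /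
    (eLpNorm f 2 lebesgue) ^ 2

/-- The dyadic uncertainty constant `UC_d(f) = V(f) V(f̂)`. -/
def dyadicUC (f : L2) : ℝ≥0∞ :=
  dyadicV f * dyadicV (walshFourierL2 f)

/-- `K₁(θ) = (2θ)^{-2θ} (1 - 2θ)^{θ - 1}`. -/
def K₁ (θ : ℝ) : ℝ := (2 * θ) ^ (-(2 * θ)) * (1 - 2 * θ) ^ (θ - 1)

/-- `C(θ) = (2 K₁(θ))^{-1/θ}`. -/
def localConst (θ : ℝ) : ℝ := (2 * K₁ θ) ^ (-1 / θ)

end DyadicUncertainty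

end

/-!
The proof derives the uncertainty principle from a local one, for the dispersion
`∫ (x ⊕ y)^{2θ} |f(x)|² dx` of order `θ < 1/2` (`dispersion`).

Plancherel's identity (`lintegral_enorm_sq_walshFourier`). The Dirichlet kernel
`∫_0^{2^n} w(t, x) w(t, y) dt` is `2^n` if `x` and `y` lie in the same dyadic cell of length `2^{-n}`
and `0` otherwise (`integral_walsh_mul_walsh`). This is also the Gram kernel of the averaging
operator `E_n` over these cells, so for integrable `f` the energy of the transform in `[0, 2^n)` is
`‖E_n f‖²`. As `n → ∞` this tends to `‖f‖²` by Jensen's inequality, Lebesgue differentiation and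
Fatou's lemma. Hence the transforms of the truncations of `f ∈ L₂` are a Cauchy sequence, the
transform exists on `L₂` and is isometric.

The local principle (`setLIntegral_enorm_sq_le_dispersion`). The dyadic ball `{x | x ⊕ y < r}` has
measure at most `r`, so `∫_{x ⊕ y < r} (x ⊕ y)^{-2θ} dx ≤ r^{1-2θ} / (1-2θ)`. Split `f` into its parts
inside and outside this ball. The transform of the first is bounded uniformly by its `L₁` norm, that
of the second in `L₂` by Plancherel's identity. With the optimal `r` the `L₂` norm of the transform
on a set of measure `R` is at most `K₁(θ) R^θ` times the square root of the dispersion of `f`.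

The global principle (`localConst_sq_le_dyadicUC`). Take the set to be a ball around `s` of radius
`R`; outside it the energy of the transform is at most `R^{-2θ}` times its dispersion around `s`.
Optimizing in `R` gives `‖f‖² ≤ 2 K₁(θ) (A B)^{1/2}` for the dispersions `A`, `B` of order `θ` of `f`
and its transform, and Hölder's inequality bounds these by the dispersions of order `1`. The infima
over the centres are positive by absolute continuity (`exists_pos_le_dispersion_one`), so that their
product is meaningful even if one of them is infinite. The numerical bound is the case `θ = 2/5`.
-/

namespace DyadicUncertainty

/-! ### Lebesgue measure on the half line -/

lemma measurableEmbedding_nnreal_coe : MeasurableEmbedding ((↑) : ℝ≥0 → ℝ) :=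
  NNReal.isClosedEmbedding_coe.measurableEmbedding

lemma lebesgue_apply (s : Set ℝ≥0) : lebesgue s = volume (((↑) : ℝ≥0 → ℝ) '' s) :=
  measurableEmbedding_nnreal_coe.comap_apply _ _

lemma map_coe_lebesgue :
    lebesgue.map ((↑) : ℝ≥0 → ℝ) = (volume : Measure ℝ).restrict (Ici 0) := by
  rw [lebesgue, measurableEmbedding_nnreal_coe.map_comap, NNReal.range_coe]

lemma lebesgue_Ico (a b : ℝ≥0) : lebesgue (Ico a b) = (b - a : ℝ≥0) := by
  have : ((↑) : ℝ≥0 → ℝ) '' Ico a b = Ico (a : ℝ) b := by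
    ext x
    simp only [mem_image, mem_Ico]
    constructor
    · rintro ⟨y, ⟨h1, h2⟩, rfl⟩
      exact ⟨by exact_mod_cast h1, by exact_mod_cast h2⟩
    · rintro ⟨h1, h2⟩
      exact ⟨⟨x, a.2.trans h1⟩, ⟨h1, h2⟩, rfl⟩
  rw [lebesgue_apply, this, Real.volume_Ico, ENNReal.ofReal, NNReal.sub_def]

lemma lebesgue_Iio (r : ℝ≥0) : lebesgue (Iio r) = r := by
  have : Iio r = Ico 0 r := by ext x; simp
  rw [this, lebesgue_Ico, tsub_zero]

instance : SigmaFinite lebesgue := by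
  refine ⟨⟨⟨fun n => Iio (n : ℝ≥0), fun _ => trivial, fun n => ?_, ?_⟩⟩⟩
  · rw [lebesgue_Iio]; exact ENNReal.coe_lt_top
  · exact iUnion_eq_univ_iff.2 fun x => exists_nat_gt x

lemma measurableEmbedding_add_right (c : ℝ≥0) : MeasurableEmbedding fun x : ℝ≥0 => x + c :=
  (measurable_id.add_const c).measurableEmbedding (add_left_injective c)

lemma comap_add_right_lebesgue (c : ℝ≥0) : lebesgue.comap (fun x => x + c) = lebesgue := by
  ext s hs
  rw [(measurableEmbedding_add_right c).comap_apply, lebesgue_apply, lebesgue_apply, image_image]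
  have : (fun x : ℝ≥0 => ((x + c : ℝ≥0) : ℝ)) '' s
      = (fun x : ℝ => x + c) '' (((↑) : ℝ≥0 → ℝ) '' s) := by
    rw [image_image]; simp
  rw [this]
  simp

/-- Change of variables `t ↦ t + c` on a set of points that are at least `c`. -/
lemma setIntegral_add_right (c : ℝ≥0) {s : Set ℝ≥0} (hs : MeasurableSet s) (hc : s ⊆ Ici c)
    (F : ℝ≥0 → ℝ) :
    ∫ t in s, F t ∂lebesgue = ∫ t in (fun x => x + c) ⁻¹' s, F (t + c) ∂lebesgue := by
  have hr : range (fun x : ℝ≥0 => x + c) = Ici c := by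
    ext x
    simp only [mem_range, mem_Ici]
    exact ⟨fun ⟨y, hy⟩ => hy ▸ le_add_self, fun h => ⟨x - c, tsub_add_cancel_of_le h⟩⟩
  conv_rhs => rw [← comap_add_right_lebesgue c]
  rw [← (measurableEmbedding_add_right c).setIntegral_map,
    (measurableEmbedding_add_right c).map_comap, Measure.restrict_restrict hs, hr,
    inter_eq_left.2 hc]

/-! ### Binary digits and the Walsh kernel -/

lemma digit_lt_two (x : ℝ≥0) (j : ℤ) : digit x j < 2 := Nat.mod_lt _ two_pos

/-- The digits of `x` are the bits of the index `⌊2^n x⌋` of its dyadic cell of length `2^{-n}`. -/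
lemma digit_eq_floor_div (x : ℝ≥0) (n : ℤ) (k : ℕ) :
    digit x (n - 1 - k) = ⌊(2 : ℝ≥0) ^ n * x⌋₊ / 2 ^ k % 2 := by
  rw [digit, ← Nat.floor_div_natCast]
  congr 2
  have : n - 1 - k + 1 = n - k := by ring
  rw [this, zpow_sub₀ two_ne_zero]
  push_cast
  rw [zpow_natCast]
  ring

lemma digit_eq_zero {x : ℝ≥0} {j : ℤ} (h : (2 : ℝ≥0) ^ (j + 1) * x < 1) : digit x j = 0 := by
  rw [digit, Nat.floor_eq_zero.2 h]

lemma digit_eq_zero_of_lt {x : ℝ≥0} {j N : ℤ} (hx : x < 2 ^ N) (h : j < -N) : digit x j = 0 := by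
  apply digit_eq_zero
  calc (2 : ℝ≥0) ^ (j + 1) * x < 2 ^ (j + 1) * 2 ^ N := by gcongr
    _ = 2 ^ (j + 1 + N) := (zpow_add₀ two_ne_zero _ _).symm
    _ ≤ 1 := zpow_le_one_of_nonpos₀ one_le_two (by lia)

lemma digit_congr {x y : ℝ≥0} {n j : ℤ} (h : ⌊(2 : ℝ≥0) ^ n * x⌋₊ = ⌊(2 : ℝ≥0) ^ n * y⌋₊)
    (hj : j < n) : digit x j = digit y j := by
  obtain ⟨k, hk⟩ : ∃ k : ℕ, j = n - 1 - k := ⟨(n - 1 - j).toNat, by lia⟩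
  rw [hk, digit_eq_floor_div, digit_eq_floor_div, h]

lemma exists_digit_ne {x y : ℝ≥0} {n : ℤ} (h : ⌊(2 : ℝ≥0) ^ n * x⌋₊ ≠ ⌊(2 : ℝ≥0) ^ n * y⌋₊) :
    ∃ j < n, digit x j ≠ digit y j := by
  obtain ⟨k, hk⟩ := Nat.exists_testBit_ne_of_ne h
  refine ⟨n - 1 - k, by lia, fun he => hk ?_⟩
  rw [digit_eq_floor_div, digit_eq_floor_div] at he
  rw [Nat.testBit_eq_decide_div_mod_eq, Nat.testBit_eq_decide_div_mod_eq, he]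

lemma exists_lt_two_pow (x : ℝ≥0) : ∃ N : ℕ, x < 2 ^ N := pow_unbounded_of_one_lt x one_lt_two

lemma measurable_digit (j : ℤ) : Measurable fun x : ℝ≥0 => digit x j :=
  (measurable_from_nat (f := fun n => n % 2)).comp
    (Nat.measurable_floor.comp (measurable_const.mul measurable_id))

lemma support_walsh_exponent {t x : ℝ≥0} {N : ℕ} (ht : t < 2 ^ N) (hx : x < 2 ^ N) :
    (Function.support fun j : ℤ => digit t j * digit x (-j - 1)) ⊆
      (Finset.Ico (-N : ℤ) N : Finset ℤ) := by
  intro j hj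
  rw [Function.mem_support] at hj
  rw [Finset.coe_Ico, mem_Ico]
  rw [← zpow_natCast] at ht hx
  by_contra hcon
  apply hj
  rcases lt_or_ge j (-N) with h | h
  · rw [digit_eq_zero_of_lt ht h, zero_mul]
  · rw [digit_eq_zero_of_lt hx (by lia), mul_zero]

lemma finite_support_walsh_exponent (t x : ℝ≥0) :
    (Function.support fun j : ℤ => digit t j * digit x (-j - 1)).Finite := by
  obtain ⟨N, hN⟩ := exists_lt_two_pow (max t x)
  exact (Finset.finite_toSet _).subset
    (support_walsh_exponent ((le_max_left _ _).trans_lt hN) ((le_max_right _ _).trans_lt hN))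

lemma walsh_eq_neg_one_pow_sum {t x : ℝ≥0} {N : ℕ} (ht : t < 2 ^ N) (hx : x < 2 ^ N) :
    walsh t x = (-1) ^ (∑ j ∈ Finset.Ico (-N : ℤ) N, digit t j * digit x (-j - 1)) := by
  rw [walsh, finsum_eq_sum_of_support_subset _ (support_walsh_exponent ht hx)]

lemma walsh_mul_self (t x : ℝ≥0) : walsh t x * walsh t x = 1 := by
  rw [walsh, ← mul_pow]; simp

lemma abs_walsh (t x : ℝ≥0) : |walsh t x| = 1 := by
  rw [walsh, abs_pow]; simp

lemma norm_walsh (t x : ℝ≥0) : ‖walsh t x‖ = 1 := abs_walsh t x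

lemma measurable_walsh : Measurable (Function.uncurry walsh) := by
  refine measurable_of_tendsto_metrizable (f := fun (N : ℕ) (p : ℝ≥0 × ℝ≥0) =>
    (-1 : ℝ) ^ (∑ j ∈ Finset.Ico (-N : ℤ) N, digit p.1 j * digit p.2 (-j - 1))) ?_ ?_
  · intro N
    refine (measurable_from_nat (f := fun n => (-1 : ℝ) ^ n)).comp ?_
    refine Finset.measurable_sum _ fun j _ => ?_
    exact ((measurable_digit j).comp measurable_fst).mul
      ((measurable_digit _).comp measurable_snd)
  · rw [tendsto_pi_nhds]
    intro p
    obtain ⟨N, hN⟩ := exists_lt_two_pow (max p.1 p.2)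
    refine tendsto_const_nhds.congr' ?_
    filter_upwards [eventually_ge_atTop N] with M hM
    have h : (2 : ℝ≥0) ^ N ≤ 2 ^ M := pow_le_pow_right₀ one_le_two hM
    exact walsh_eq_neg_one_pow_sum (((le_max_left _ _).trans_lt hN).trans_le h)
      (((le_max_right _ _).trans_lt hN).trans_le h)

/-- Adding `2^i` to `t` flips the digit of `t` at place `-i-1`. -/
lemma digit_add_zpow_self (t : ℝ≥0) (i : ℤ) :
    digit (t + 2 ^ i) (-i - 1) = (digit t (-i - 1) + 1) % 2 := by
  have h : (2 : ℝ≥0) ^ (-i - 1 + 1) * (t + 2 ^ i) = 2 ^ (-i - 1 + 1) * t + 1 := by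
    rw [mul_add, ← zpow_add₀ two_ne_zero]; simp
  rw [digit, digit, h, Nat.floor_add_one (by positivity)]
  simp

/-- No carry occurs when `2^i` is added to a `t` whose digit at place `-i-1` vanishes. -/
lemma digit_add_zpow {t : ℝ≥0} {i : ℤ} (h : digit t (-i - 1) = 0) (j : ℤ) :
    digit (t + 2 ^ i) j = digit t j + if j = -i - 1 then 1 else 0 := by
  rcases lt_trichotomy j (-i - 1) with hj | rfl | hj
  · rw [if_neg hj.ne, add_zero]
    obtain ⟨k, rfl⟩ : ∃ k : ℕ, j = -i - 1 - (k + 1 : ℕ) := ⟨(-i - 1 - j - 1).toNat, by lia⟩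
    rw [digit_eq_floor_div, digit_eq_floor_div, mul_add, ← zpow_add₀ two_ne_zero]
    have h2 := digit_eq_floor_div t (-i) 0
    simp only [Nat.cast_zero, sub_zero, pow_zero, Nat.div_one] at h2
    rw [h2] at h
    rw [neg_add_cancel, zpow_zero, Nat.floor_add_one (by positivity), pow_succ',
      ← Nat.div_div_eq_div_mul, ← Nat.div_div_eq_div_mul]
    congr 2
    lia
  · rw [digit_add_zpow_self, h]; simp
  · rw [if_neg hj.ne', add_zero]
    obtain ⟨k, rfl⟩ : ∃ k : ℕ, j = -i - 1 + (k + 1 : ℕ) := ⟨(j - (-i - 1) - 1).toNat, by lia⟩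
    have h2 : (2 : ℝ≥0) ^ (-i - 1 + (k + 1 : ℕ) + 1) * (t + 2 ^ i)
        = 2 ^ (-i - 1 + (k + 1 : ℕ) + 1) * t + (2 * 2 ^ k : ℕ) := by
      rw [mul_add, ← zpow_add₀ two_ne_zero]
      congr 1
      have : -i - 1 + ((k + 1 : ℕ) : ℤ) + 1 + i = (k + 1 : ℕ) := by push_cast; ring
      rw [this, zpow_natCast, pow_succ']
      push_cast; rfl
    rw [digit, digit, h2, Nat.floor_add_natCast (by positivity)]
    lia

lemma walsh_add_zpow {t : ℝ≥0} {i : ℤ} (h : digit t (-i - 1) = 0) (x : ℝ≥0) :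
    walsh (t + 2 ^ i) x = walsh t x * (-1) ^ digit x i := by
  have h1 : ∀ j, digit (t + 2 ^ i) j * digit x (-j - 1)
      = digit t j * digit x (-j - 1) + if j = -i - 1 then digit x i else 0 := by
    intro j
    rw [digit_add_zpow h, add_mul]
    split_ifs with hj
    · rw [hj, one_mul]; congr 2; ring
    · rw [zero_mul]
  rw [walsh, walsh, ← pow_add]
  congr 1
  simp_rw [h1]
  rw [finsum_add_distrib (finite_support_walsh_exponent t x)]
  · congr 1
    rw [finsum_eq_single _ (-i - 1)]
    · simp
    · intro j hj; simp [hj]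
  · exact (finite_singleton (-i - 1)).subset fun j hj => by
      by_contra hc; exact hj (if_neg hc)

/-- The kernel of the averaging operator over dyadic cells of length `2^{-n}`. -/
noncomputable def cellKernel (n : ℕ) (x y : ℝ≥0) : ℝ :=
  if ⌊(2 : ℝ≥0) ^ n * x⌋₊ = ⌊(2 : ℝ≥0) ^ n * y⌋₊ then 2 ^ n else 0

lemma walsh_mul_walsh_of_same_cell {n : ℕ} {t x y : ℝ≥0} (ht : t < 2 ^ n)
    (h : ⌊(2 : ℝ≥0) ^ n * x⌋₊ = ⌊(2 : ℝ≥0) ^ n * y⌋₊) : walsh t x * walsh t y = 1 := by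
  have : walsh t x = walsh t y := by
    rw [walsh, walsh]
    congr 1
    refine finsum_congr fun j => ?_
    rw [← zpow_natCast] at ht h
    rcases lt_or_ge j (-n) with hj | hj
    · rw [digit_eq_zero_of_lt ht hj, zero_mul, zero_mul]
    · rw [digit_congr h (by lia)]
  rw [this, walsh_mul_self]

lemma add_zpow_lt_two_pow {n : ℕ} {i : ℤ} (hi : i < n) {t : ℝ≥0} (h : digit t (-i - 1) = 0)
    (ht : t < 2 ^ n) : t + 2 ^ i < 2 ^ n := by
  obtain ⟨k, hk⟩ : ∃ k : ℕ, (n : ℤ) = i + (k + 1 : ℕ) := ⟨(n - i - 1).toNat, by lia⟩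
  have hp : (0 : ℝ≥0) < 2 ^ i := by positivity
  have h2 : (2 : ℝ≥0) ^ n = 2 ^ i * (2 * 2 ^ k : ℕ) := by
    rw [← zpow_natCast, hk, zpow_add₀ two_ne_zero, zpow_natCast, pow_succ']
    push_cast; rfl
  have h3 : (2 : ℝ≥0) ^ (-i) * t < (2 * 2 ^ k : ℕ) := by
    rw [h2] at ht
    rw [zpow_neg]
    rwa [inv_mul_lt_iff₀ hp]
  have h4 := (Nat.floor_lt (by positivity)).2 h3
  have h5 := digit_eq_floor_div t (-i) 0
  simp only [Nat.cast_zero, sub_zero, pow_zero, Nat.div_one] at h5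
  rw [h] at h5
  have h6 : ⌊(2 : ℝ≥0) ^ (-i) * t⌋₊ + 2 ≤ 2 * 2 ^ k := by lia
  have h7 := Nat.lt_floor_add_one ((2 : ℝ≥0) ^ (-i) * t)
  have h8 : ((⌊(2 : ℝ≥0) ^ (-i) * t⌋₊ + 2 : ℕ) : ℝ≥0) ≤ (2 * 2 ^ k : ℕ) := by exact_mod_cast h6
  have h9 : (2 : ℝ≥0) ^ (-i) * t + 1 < (2 * 2 ^ k : ℕ) := by
    refine lt_of_lt_of_le ?_ h8
    push_cast
    calc (2 : ℝ≥0) ^ (-i) * t + 1 < ⌊(2 : ℝ≥0) ^ (-i) * t⌋₊ + 1 + 1 := by gcongr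
      _ = _ := by ring
  calc t + 2 ^ i = 2 ^ i * ((2 : ℝ≥0) ^ (-i) * t + 1) := by
        rw [mul_add, ← mul_assoc, ← zpow_add₀ two_ne_zero]; simp
    _ < 2 ^ i * (2 * 2 ^ k : ℕ) := by gcongr
    _ = 2 ^ n := h2.symm

lemma measurable_walsh_left (x : ℝ≥0) : Measurable fun t => walsh t x :=
  measurable_walsh.of_uncurry_right

lemma integrableOn_walsh_mul (n : ℕ) (x y : ℝ≥0) :
    IntegrableOn (fun t => walsh t x * walsh t y) (Iio (2 ^ n)) lebesgue := by
  refine IntegrableOn.of_bound (C := 1) ?_ ?_ ?_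
  · rw [lebesgue_Iio]; exact ENNReal.coe_lt_top
  · exact ((measurable_walsh_left x).mul (measurable_walsh_left y)).aestronglyMeasurable
  · exact .of_forall fun t => by rw [norm_mul, norm_walsh, norm_walsh, one_mul]

/-- Orthogonality: the Dirichlet kernel of order `2^n` is the averaging kernel. In the
off-diagonal case the shift by `2^i`, where `i` is a place at which `x` and `y` differ, exchanges
two halves of `[0, 2^n)` and changes the sign of the integrand. -/
lemma integral_walsh_mul_walsh (n : ℕ) (x y : ℝ≥0) :
    ∫ t in Iio (2 ^ n), walsh t x * walsh t y ∂lebesgue = cellKernel n x y := by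
  rw [cellKernel]
  split_ifs with h
  · rw [setIntegral_congr_fun measurableSet_Iio (g := fun _ => 1)
      fun t ht => walsh_mul_walsh_of_same_cell ht h]
    simp [Measure.real, lebesgue_Iio]
  · obtain ⟨i, hi, hne⟩ := exists_digit_ne (n := n) (by rwa [zpow_natCast])
    set A : Set ℝ≥0 := Iio (2 ^ n) ∩ {t | digit t (-i - 1) = 0} with hA
    set B : Set ℝ≥0 := Iio (2 ^ n) ∩ {t | digit t (-i - 1) = 0}ᶜ with hB
    have hm : MeasurableSet {t | digit t (-i - 1) = 0} :=
      measurable_digit _ (measurableSet_singleton 0)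
    have hBc : B ⊆ Ici (2 ^ i) := by
      intro t ht
      by_contra hc
      refine ht.2 (digit_eq_zero ?_)
      rw [mem_Ici, not_le] at hc
      calc (2 : ℝ≥0) ^ (-i - 1 + 1) * t < 2 ^ (-i - 1 + 1) * 2 ^ i := by gcongr
        _ = 1 := by rw [← zpow_add₀ two_ne_zero]; simp
    have hpre : (fun t : ℝ≥0 => t + 2 ^ i) ⁻¹' B = A := by
      ext t
      simp only [hA, hB, mem_preimage, mem_inter_iff, mem_Iio, mem_compl_iff, mem_ofPred_eq,
        digit_add_zpow_self]
      have := digit_lt_two t (-i - 1)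
      constructor
      · rintro ⟨h1, h2⟩
        exact ⟨lt_of_le_of_lt le_self_add h1, by lia⟩
      · rintro ⟨h1, h2⟩
        exact ⟨add_zpow_lt_two_pow hi h2 h1, by lia⟩
    have key : ∫ t in B, walsh t x * walsh t y ∂lebesgue
        = -∫ t in A, walsh t x * walsh t y ∂lebesgue := by
      rw [setIntegral_add_right (2 ^ i) (measurableSet_Iio.inter hm.compl) hBc, hpre,
        ← integral_neg]
      refine setIntegral_congr_fun (measurableSet_Iio.inter hm) fun t ht => ?_
      rw [walsh_add_zpow ht.2, walsh_add_zpow ht.2]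
      have hx := digit_lt_two x i
      have hy := digit_lt_two y i
      interval_cases digit x i <;> interval_cases digit y i <;> first | exact absurd rfl hne | ring
    rw [← integral_inter_add_sdiff hm (integrableOn_walsh_mul n x y), Set.sdiff_eq, ← hA]
    exact (congrArg _ key).trans (add_neg_cancel _)

/-! ### Averages over dyadic cells -/

lemma setOf_floor_eq (n k : ℕ) :
    {y : ℝ≥0 | ⌊(2 : ℝ≥0) ^ n * y⌋₊ = k} = Ico ((k : ℝ≥0) / 2 ^ n) ((k + 1) / 2 ^ n) := by
  ext y
  have hp : (0 : ℝ≥0) < 2 ^ n := by positivity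
  rw [mem_ofPred_eq, Nat.floor_eq_iff (by positivity), mem_Ico, div_le_iff₀' hp, lt_div_iff₀' hp]

lemma lebesgue_floor_eq (n k : ℕ) :
    lebesgue {y : ℝ≥0 | ⌊(2 : ℝ≥0) ^ n * y⌋₊ = k} = (2 ^ n)⁻¹ := by
  rw [setOf_floor_eq, lebesgue_Ico, ← NNReal.sub_div, add_tsub_cancel_left, one_div,
    ENNReal.coe_inv (by positivity)]
  simp

lemma measurableSet_floor_eq (n k : ℕ) :
    MeasurableSet {y : ℝ≥0 | ⌊(2 : ℝ≥0) ^ n * y⌋₊ = k} := by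
  rw [setOf_floor_eq]; exact measurableSet_Ico

lemma measurable_floor_two_pow_mul (n : ℕ) : Measurable fun y : ℝ≥0 => ⌊(2 : ℝ≥0) ^ n * y⌋₊ :=
  Nat.measurable_floor.comp (measurable_const.mul measurable_id)

lemma measurable_cellKernel (n : ℕ) : Measurable (Function.uncurry (cellKernel n)) := by
  refine Measurable.ite ?_ measurable_const measurable_const
  exact measurableSet_eq_fun ((measurable_floor_two_pow_mul n).comp measurable_fst)
    ((measurable_floor_two_pow_mul n).comp measurable_snd)

lemma cellKernel_comm (n : ℕ) (x y : ℝ≥0) : cellKernel n x y = cellKernel n y x := by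
  simp only [cellKernel, eq_comm]

lemma enorm_cellKernel (n : ℕ) (x y : ℝ≥0) : ‖cellKernel n x y‖ₑ =
    {y : ℝ≥0 | ⌊(2 : ℝ≥0) ^ n * y⌋₊ = ⌊(2 : ℝ≥0) ^ n * x⌋₊}.indicator (fun _ => 2 ^ n) y := by
  by_cases h : ⌊(2 : ℝ≥0) ^ n * y⌋₊ = ⌊(2 : ℝ≥0) ^ n * x⌋₊
  · rw [indicator_of_mem (by exact h), cellKernel, if_pos h.symm, enorm_pow]
    congr 1
    rw [← ofReal_norm]; simp
  · rw [indicator_of_notMem (by exact h), cellKernel, if_neg (Ne.symm h), enorm_zero]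

lemma enorm_complex_ofReal (r : ℝ) : ‖(r : ℂ)‖ₑ = ‖r‖ₑ := by
  rw [← ofReal_norm, ← ofReal_norm, Complex.norm_real]

lemma lintegral_enorm_cellKernel (n : ℕ) (x : ℝ≥0) :
    ∫⁻ y, ‖cellKernel n x y‖ₑ ∂lebesgue = 1 := by
  simp_rw [enorm_cellKernel]
  rw [lintegral_indicator_const (measurableSet_floor_eq n _), lebesgue_floor_eq]
  exact ENNReal.mul_inv_cancel (by positivity) (by finiteness)

lemma cellKernel_mul_cellKernel (n : ℕ) (z x y : ℝ≥0) :
    cellKernel n z x * cellKernel n z y = cellKernel n x y * cellKernel n x z := by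
  simp only [cellKernel]
  split_ifs <;> simp_all

lemma integral_cellKernel (n : ℕ) (x : ℝ≥0) : ∫ y, cellKernel n x y ∂lebesgue = 1 := by
  rw [integral_eq_lintegral_of_nonneg_ae]
  · have := lintegral_enorm_cellKernel n x
    rw [lintegral_congr (g := fun y => ENNReal.ofReal (cellKernel n x y))] at this
    · rw [this, ENNReal.toReal_one]
    · intro y
      rw [Real.enorm_of_nonneg]
      rw [cellKernel]; split_ifs <;> positivity
  · refine .of_forall fun y => ?_
    simp only [cellKernel, Pi.zero_apply]; split_ifs <;> positivity
  · exact (measurable_cellKernel n).of_uncurry_left.aestronglyMeasurable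

lemma integral_cellKernel_mul_cellKernel (n : ℕ) (x y : ℝ≥0) :
    ∫ z, cellKernel n z x * cellKernel n z y ∂lebesgue = cellKernel n x y := by
  simp_rw [cellKernel_mul_cellKernel]
  rw [integral_const_mul, integral_cellKernel, mul_one]

/-- The extension of a function on the half line by zero. -/
noncomputable def zeroExtend (f : ℝ≥0 → ℂ) : ℝ → ℂ := (Ici 0).indicator fun u => f u.toNNReal

lemma zeroExtend_coe (f : ℝ≥0 → ℂ) (x : ℝ≥0) : zeroExtend f x = f x := by
  rw [zeroExtend, indicator_of_mem (show (x : ℝ) ∈ Ici (0 : ℝ) from x.2), Real.toNNReal_coe]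

lemma integrable_zeroExtend {f : ℝ≥0 → ℂ} (hf : Integrable f lebesgue) :
    Integrable (zeroExtend f) := by
  have h1 : IntegrableOn (zeroExtend f) (Ici 0) := by
    rw [IntegrableOn, ← map_coe_lebesgue, measurableEmbedding_nnreal_coe.integrable_map_iff]
    exact hf.congr (.of_forall fun x => (zeroExtend_coe f x).symm)
  rw [← integrable_indicator_iff measurableSet_Ici] at h1
  rwa [zeroExtend, indicator_indicator, inter_self] at h1

lemma setIntegral_zeroExtend (f : ℝ≥0 → ℂ) (a b : ℝ≥0) :
    ∫ u in Icc (a : ℝ) b, zeroExtend f u = ∫ y in Ico a b, f y ∂lebesgue := by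
  have h0 : Ico (a : ℝ) b ⊆ Ici 0 := fun u hu => a.2.trans hu.1
  have h1 : ((↑) : ℝ≥0 → ℝ) ⁻¹' Ico (a : ℝ) b = Ico a b := by
    ext y; simp
  rw [← setIntegral_congr_set Ico_ae_eq_Icc, ← inter_eq_left.2 h0,
    ← Measure.restrict_restrict measurableSet_Ico, ← map_coe_lebesgue,
    measurableEmbedding_nnreal_coe.setIntegral_map, h1]
  simp_rw [zeroExtend_coe]

lemma integral_mul_cellKernel (f : ℝ≥0 → ℂ) (n : ℕ) (x : ℝ≥0) :
    ∫ y, f y * cellKernel n x y ∂lebesgue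
      = 2 ^ n * ∫ y in {y : ℝ≥0 | ⌊(2 : ℝ≥0) ^ n * y⌋₊ = ⌊(2 : ℝ≥0) ^ n * x⌋₊}, f y ∂lebesgue := by
  rw [← integral_const_mul, ← integral_indicator (measurableSet_floor_eq n _)]
  refine integral_congr_ae (.of_forall fun y => ?_)
  by_cases h : ⌊(2 : ℝ≥0) ^ n * y⌋₊ = ⌊(2 : ℝ≥0) ^ n * x⌋₊
  · simp only
    rw [indicator_of_mem (by exact h), cellKernel, if_pos h.symm]
    push_cast; ring
  · simp only
    rw [indicator_of_notMem (by exact h), cellKernel, if_neg (Ne.symm h)]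
    simp

/-- Lebesgue differentiation along dyadic cells. -/
lemma ae_tendsto_integral_mul_cellKernel {f : ℝ≥0 → ℂ} (hf : Integrable f lebesgue) :
    ∀ᵐ x ∂lebesgue, Tendsto (fun n : ℕ => ∫ y, f y * cellKernel n x y ∂lebesgue) atTop
      (𝓝 (f x)) := by
  have h := IsUnifLocDoublingMeasure.ae_tendsto_average volume
    (integrable_zeroExtend hf).locallyIntegrable 1
  have h2 := ae_restrict_of_ae (s := Ici (0 : ℝ)) h
  rw [← map_coe_lebesgue, measurableEmbedding_nnreal_coe.ae_map_iff] at h2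
  filter_upwards [h2] with x hx
  rw [zeroExtend_coe] at hx
  have h3 := hx (l := atTop) (fun n : ℕ => (⌊(2 : ℝ≥0) ^ n * x⌋₊ + 1 / 2 : ℝ) / 2 ^ n)
    (fun n : ℕ => (1 / 2 : ℝ) / 2 ^ n) ?_ ?_
  · refine h3.congr fun n => ?_
    set k := ⌊(2 : ℝ≥0) ^ n * x⌋₊ with hk
    rw [integral_mul_cellKernel, setOf_floor_eq, ← setIntegral_zeroExtend, Real.closedBall_eq_Icc,
      setAverage_eq, ← sub_div, ← add_div, Measure.real, Real.volume_Icc]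
    have e1 : (((k : ℝ≥0) / 2 ^ n : ℝ≥0) : ℝ) = ((k : ℝ) + 1 / 2 - 1 / 2) / 2 ^ n := by
      push_cast; ring
    have e2 : ((((k : ℝ≥0) + 1) / 2 ^ n : ℝ≥0) : ℝ) = ((k : ℝ) + 1 / 2 + 1 / 2) / 2 ^ n := by
      push_cast; ring
    have e3 : ((k : ℝ) + 1 / 2 + 1 / 2) / 2 ^ n - ((k : ℝ) + 1 / 2 - 1 / 2) / 2 ^ n
        = (2 ^ n)⁻¹ := by ring
    rw [← hk, e1, e2, e3, ENNReal.toReal_ofReal (by positivity), inv_inv, Complex.real_smul]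
    push_cast; rfl
  · refine tendsto_nhdsWithin_iff.2 ⟨?_, .of_forall fun n => ?_⟩
    · exact tendsto_const_nhds.div_atTop (tendsto_pow_atTop_atTop_of_one_lt one_lt_two)
    · exact mem_Ioi.2 (by positivity)
  · refine .of_forall fun n => ?_
    have hp : (0 : ℝ) < 2 ^ n := by positivity
    have l1 : (⌊(2 : ℝ≥0) ^ n * x⌋₊ : ℝ) ≤ 2 ^ n * x := by
      exact_mod_cast Nat.floor_le (a := (2 : ℝ≥0) ^ n * x) (by positivity)
    have l2 : (2 : ℝ) ^ n * x < ⌊(2 : ℝ≥0) ^ n * x⌋₊ + 1 := by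
      exact_mod_cast Nat.lt_floor_add_one ((2 : ℝ≥0) ^ n * x)
    rw [Real.closedBall_eq_Icc, one_mul, ← sub_div, ← add_div, mem_Icc, div_le_iff₀' hp,
      le_div_iff₀' hp]
    constructor <;> linarith

/-- Jensen's inequality for averages over dyadic cells. -/
lemma lintegral_enorm_sq_integral_mul_cellKernel_le {f : ℝ≥0 → ℂ}
    (hf : AEStronglyMeasurable f lebesgue) (n : ℕ) :
    ∫⁻ x, ‖∫ y, f y * cellKernel n x y ∂lebesgue‖ₑ ^ 2 ∂lebesgue
      ≤ ∫⁻ y, ‖f y‖ₑ ^ 2 ∂lebesgue := by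
  have hD : Measurable fun p : ℝ≥0 × ℝ≥0 => ‖cellKernel n p.1 p.2‖ₑ :=
    (measurable_cellKernel n).enorm
  have h1 : ∀ x, ‖∫ y, f y * cellKernel n x y ∂lebesgue‖ₑ ^ 2
      ≤ ∫⁻ y, ‖f y‖ₑ ^ 2 * ‖cellKernel n x y‖ₑ ∂lebesgue := by
    intro x
    have hDx : Measurable fun y => ‖cellKernel n x y‖ₑ :=
      (measurable_cellKernel n).of_uncurry_left.enorm
    have h2 := ENNReal.lintegral_mul_norm_pow_le (μ := lebesgue)
      (f := fun y => ‖f y‖ₑ ^ 2 * ‖cellKernel n x y‖ₑ)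
      (g := fun y => ‖cellKernel n x y‖ₑ) ((hf.enorm.pow_const 2).mul hDx.aemeasurable)
      hDx.aemeasurable (p := 1 / 2) (q := 1 / 2) (by norm_num) (by norm_num) (by norm_num)
    rw [lintegral_enorm_cellKernel, ENNReal.one_rpow, mul_one] at h2
    have h3 : ‖∫ y, f y * cellKernel n x y ∂lebesgue‖ₑ
        ≤ (∫⁻ y, ‖f y‖ₑ ^ 2 * ‖cellKernel n x y‖ₑ ∂lebesgue) ^ (1 / 2 : ℝ) := by
      refine (enorm_integral_le_lintegral_enorm _).trans (le_trans (le_of_eq ?_) h2)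
      refine lintegral_congr fun y => ?_
      rw [ENNReal.mul_rpow_of_nonneg _ _ (by norm_num), mul_assoc,
        ← ENNReal.rpow_add_of_nonneg _ _ (by norm_num) (by norm_num), ← ENNReal.rpow_natCast,
        ← ENNReal.rpow_mul]
      norm_num [enorm_mul, enorm_complex_ofReal]
    calc _ ≤ ((∫⁻ y, ‖f y‖ₑ ^ 2 * ‖cellKernel n x y‖ₑ ∂lebesgue) ^ (1 / 2 : ℝ)) ^ 2 := by gcongr
      _ = _ := by
        rw [← ENNReal.rpow_natCast, ← ENNReal.rpow_mul]; norm_num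
  refine (lintegral_mono h1).trans (le_of_eq ?_)
  rw [lintegral_lintegral_swap]
  · refine lintegral_congr fun y => ?_
    rw [lintegral_const_mul _ (measurable_cellKernel n).of_uncurry_right.enorm]
    simp_rw [cellKernel_comm n _ y]
    rw [lintegral_enorm_cellKernel, mul_one]
  · exact (hf.enorm.pow_const 2).comp_snd.mul hD.aemeasurable

/-! ### Plancherel's identity for integrable functions -/

/-- The `TT*` identity: the square norm of `∫ f(x) k(·, x) dx` is the quadratic form of the Gram
kernel `∫ k(z, x) k(z, y) dz`. -/
lemma lintegral_enorm_sq_integral_mul_kernel {X Z : Type*} [MeasurableSpace X] [MeasurableSpace Z]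
    {μ : Measure X} {ν : Measure Z} [SFinite μ] [SFinite ν] {k : Z → X → ℝ}
    (hk : Measurable (Function.uncurry k)) {C : ℝ≥0∞} (hC : C ≠ ∞)
    (hkC : ∀ x y, ∫⁻ z, ‖k z x‖ₑ * ‖k z y‖ₑ ∂ν ≤ C) {f : X → ℂ} (hf : Integrable f μ) :
    ∫⁻ z, ‖∫ x, f x * k z x ∂μ‖ₑ ^ 2 ∂ν = ENNReal.ofReal
      (∫ p : X × X, f p.1 * star (f p.2) * ((∫ z, k z p.1 * k z p.2 ∂ν : ℝ) : ℂ) ∂μ.prod μ).re := by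
  have hff : Integrable (fun p : X × X => f p.1 * star (f p.2)) (μ.prod μ) :=
    hf.mul_prod ((RCLike.conjCLE (K := ℂ)).toContinuousLinearMap.integrable_comp hf)
  have hk1 : Measurable fun q : Z × X × X => k q.1 q.2.1 :=
    hk.comp (measurable_fst.prodMk (measurable_fst.comp measurable_snd))
  have hk2 : Measurable fun q : Z × X × X => k q.1 q.2.2 :=
    hk.comp (measurable_fst.prodMk (measurable_snd.comp measurable_snd))
  set G : Z × X × X → ℂ := fun q => f q.2.1 * star (f q.2.2) * ((k q.1 q.2.1 * k q.1 q.2.2 : ℝ) : ℂ)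
    with hG
  have hGm : AEStronglyMeasurable G (ν.prod (μ.prod μ)) :=
    hff.1.comp_snd.mul (Complex.measurable_ofReal.comp (hk1.mul hk2)).aestronglyMeasurable
  have hGi : Integrable G (ν.prod (μ.prod μ)) := by
    refine ⟨hGm, ?_⟩
    rw [HasFiniteIntegral, lintegral_prod_symm _ hGm.enorm]
    calc _ ≤ ∫⁻ p : X × X, ‖f p.1 * star (f p.2)‖ₑ * C ∂μ.prod μ := by
          refine lintegral_mono fun p => ?_
          simp only [hG, enorm_mul]
          rw [lintegral_const_mul]
          · gcongr
            refine le_trans (le_of_eq ?_) (hkC p.1 p.2)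
            refine lintegral_congr fun z => ?_
            rw [← enorm_mul, enorm_complex_ofReal]
          · exact (Complex.measurable_ofReal.comp
              ((hk1.mul hk2).comp measurable_prodMk_right)).enorm
      _ = (∫⁻ p : X × X, ‖f p.1 * star (f p.2)‖ₑ ∂μ.prod μ) * C :=
          lintegral_mul_const' _ _ hC
      _ < ∞ := ENNReal.mul_lt_top hff.2 hC.lt_top
  have hz : ∀ z, ∫ p : X × X, G (z, p) ∂μ.prod μ = ((‖∫ x, f x * k z x ∂μ‖ ^ 2 : ℝ) : ℂ) := by
    intro z
    have : ∀ p : X × X, G (z, p) = (f p.1 * k z p.1) * star (f p.2 * k z p.2) := by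
      intro p; simp [hG]; ring
    simp_rw [this]
    rw [integral_prod_mul (fun x => f x * (k z x : ℂ)) fun x => star (f x * (k z x : ℂ))]
    have h2 : ∫ x, star (f x * (k z x : ℂ)) ∂μ = star (∫ x, f x * (k z x : ℂ) ∂μ) := integral_conj
    rw [h2, Complex.star_def, Complex.mul_conj, Complex.normSq_eq_norm_sq]
  have hI : Integrable (fun z => ‖∫ x, f x * k z x ∂μ‖ ^ 2) ν := by
    have h := hGi.integral_prod_left.re
    refine h.congr (.of_forall fun z => ?_)
    simp only [hz]
    exact Complex.ofReal_re _
  have e1 : ∀ z, ‖∫ x, f x * k z x ∂μ‖ₑ ^ 2 = ENNReal.ofReal (‖∫ x, f x * k z x ∂μ‖ ^ 2) := by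
    intro z
    rw [← ofReal_norm, ENNReal.ofReal_pow (norm_nonneg _)]
  simp_rw [e1]
  rw [← ofReal_integral_eq_lintegral_ofReal hI (.of_forall fun z => by positivity)]
  congr 1
  rw [← Complex.ofReal_re (∫ z, ‖∫ x, f x * k z x ∂μ‖ ^ 2 ∂ν), ← integral_complex_ofReal]
  simp_rw [← hz]
  rw [integral_integral_swap (f := fun z p => G (z, p)) hGi]
  congr 1
  refine integral_congr_ae (.of_forall fun p => ?_)
  simp only [hG]
  rw [integral_const_mul, integral_complex_ofReal]

/-- The energy of the transform in `[0, 2^n)` is the energy of the averages of `f` over dyadic cells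
of length `2^{-n}`, as the two operators have the same Gram kernel. -/
lemma setLIntegral_enorm_sq_walshFourier {f : ℝ≥0 → ℂ} (hf : Integrable f lebesgue) (n : ℕ) :
    ∫⁻ t in Iio (2 ^ n), ‖walshFourier f t‖ₑ ^ 2 ∂lebesgue
      = ∫⁻ x, ‖∫ y, f y * cellKernel n x y ∂lebesgue‖ₑ ^ 2 ∂lebesgue := by
  simp_rw [walshFourier]
  rw [lintegral_enorm_sq_integral_mul_kernel measurable_walsh (C := 2 ^ n) (by finiteness) _ hf,
    lintegral_enorm_sq_integral_mul_kernel (measurable_cellKernel n) (C := 2 ^ n) (by finiteness)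
      _ hf]
  · simp_rw [integral_walsh_mul_walsh, integral_cellKernel_mul_cellKernel]
  · intro x y
    simp_rw [← enorm_mul, cellKernel_mul_cellKernel, enorm_mul]
    rw [lintegral_const_mul _ (measurable_cellKernel n).of_uncurry_left.enorm,
      lintegral_enorm_cellKernel, mul_one, enorm_cellKernel]
    exact indicator_le_self _ _ _
  · intro x y
    have : ∀ t x, ‖walsh t x‖ₑ = 1 := fun t x => by rw [← ofReal_norm, norm_walsh]; simp
    simp [this, lebesgue_Iio]

lemma stronglyMeasurable_walshFourier {f : ℝ≥0 → ℂ} (hf : StronglyMeasurable f) :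
    StronglyMeasurable (walshFourier f) := by
  have h : StronglyMeasurable fun p : ℝ≥0 × ℝ≥0 => f p.2 * (walsh p.1 p.2 : ℂ) :=
    (hf.comp_measurable measurable_snd).mul
      (Complex.measurable_ofReal.comp measurable_walsh).stronglyMeasurable
  exact h.integral_prod_right

lemma walshFourier_congr {f g : ℝ≥0 → ℂ} (h : f =ᵐ[lebesgue] g) :
    walshFourier f = walshFourier g := by
  funext t
  exact integral_congr_ae (h.mono fun x hx => by simp only [hx])

lemma measurable_walshFourier {f : ℝ≥0 → ℂ} (hf : AEStronglyMeasurable f lebesgue) :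
    StronglyMeasurable (walshFourier f) := by
  rw [walshFourier_congr hf.ae_eq_mk]
  exact stronglyMeasurable_walshFourier hf.stronglyMeasurable_mk

/-- Plancherel's identity. -/
lemma lintegral_enorm_sq_walshFourier {f : ℝ≥0 → ℂ} (hf : Integrable f lebesgue) :
    ∫⁻ t, ‖walshFourier f t‖ₑ ^ 2 ∂lebesgue = ∫⁻ x, ‖f x‖ₑ ^ 2 ∂lebesgue := by
  apply le_antisymm
  · have hu : (⋃ n : ℕ, Iio ((2 : ℝ≥0) ^ n)) = univ :=
      iUnion_eq_univ_iff.2 fun x => exists_lt_two_pow x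
    have hm : Monotone fun n : ℕ => Iio ((2 : ℝ≥0) ^ n) := fun a b hab =>
      Iio_subset_Iio (pow_le_pow_right₀ one_le_two hab)
    rw [← setLIntegral_univ, ← hu, setLIntegral_iUnion_of_directed _ hm.directed_le]
    refine iSup_le fun n => ?_
    rw [setLIntegral_enorm_sq_walshFourier hf]
    exact lintegral_enorm_sq_integral_mul_cellKernel_le hf.1 n
  · have hm : ∀ n : ℕ, AEMeasurable
        (fun x => ‖∫ y, f y * cellKernel n x y ∂lebesgue‖ₑ ^ 2) lebesgue := by
      intro n
      have h : AEStronglyMeasurable (fun p : ℝ≥0 × ℝ≥0 => f p.2 * (cellKernel n p.1 p.2 : ℂ))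
          (lebesgue.prod lebesgue) := hf.1.comp_snd.mul
        (Complex.measurable_ofReal.comp (measurable_cellKernel n)).aestronglyMeasurable
      exact h.integral_prod_right'.enorm.pow_const 2
    calc ∫⁻ x, ‖f x‖ₑ ^ 2 ∂lebesgue
        = ∫⁻ x, liminf (fun n : ℕ => ‖∫ y, f y * cellKernel n x y ∂lebesgue‖ₑ ^ 2) atTop
            ∂lebesgue := by
          refine lintegral_congr_ae ?_
          filter_upwards [ae_tendsto_integral_mul_cellKernel hf] with x hx
          exact ((ENNReal.continuous_pow 2).tendsto _ |>.comp hx.enorm).liminf_eq.symm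
      _ ≤ liminf (fun n : ℕ => ∫⁻ x, ‖∫ y, f y * cellKernel n x y ∂lebesgue‖ₑ ^ 2 ∂lebesgue)
            atTop := lintegral_liminf_le' hm
      _ ≤ ∫⁻ t, ‖walshFourier f t‖ₑ ^ 2 ∂lebesgue := by
          refine liminf_le_of_le (by isBoundedDefault) fun b hb => ?_
          obtain ⟨n, hn⟩ := hb.exists
          rw [← setLIntegral_enorm_sq_walshFourier hf] at hn
          exact hn.trans (setLIntegral_le_lintegral _ _)

/-! ### The Walsh-Fourier transform on `L₂` -/

lemma eLpNorm_two_sq {X : Type*} [MeasurableSpace X] (f : X → ℂ) (μ : Measure X) :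
    eLpNorm f 2 μ ^ 2 = ∫⁻ x, ‖f x‖ₑ ^ 2 ∂μ := by
  have := eLpNorm_nnreal_pow_eq_lintegral (f := f) (μ := μ) (p := 2) two_ne_zero
  simpa using this

lemma eLpNorm_walshFourier {f : ℝ≥0 → ℂ} (hf : Integrable f lebesgue) :
    eLpNorm (walshFourier f) 2 lebesgue = eLpNorm f 2 lebesgue := by
  refine (ENNReal.pow_right_strictMono two_ne_zero).injective ?_
  simp only [eLpNorm_two_sq]
  exact lintegral_enorm_sq_walshFourier hf

lemma integrable_mul_walsh {f : ℝ≥0 → ℂ} (hf : Integrable f lebesgue) (t : ℝ≥0) :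
    Integrable (fun x => f x * (walsh t x : ℂ)) lebesgue := by
  refine hf.mul_bdd (c := 1) ?_ (.of_forall fun x => ?_)
  · exact (Complex.measurable_ofReal.comp measurable_walsh.of_uncurry_left).aestronglyMeasurable
  · rw [Complex.norm_real, norm_walsh]

lemma walshFourier_sub {f g : ℝ≥0 → ℂ} (hf : Integrable f lebesgue) (hg : Integrable g lebesgue) :
    walshFourier (f - g) = walshFourier f - walshFourier g := by
  funext t
  simp only [walshFourier, Pi.sub_apply, sub_mul]
  exact integral_sub (integrable_mul_walsh hf t) (integrable_mul_walsh hg t)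

lemma walshFourier_add {f g : ℝ≥0 → ℂ} (hf : Integrable f lebesgue) (hg : Integrable g lebesgue) :
    walshFourier (f + g) = walshFourier f + walshFourier g := by
  funext t
  simp only [walshFourier, Pi.add_apply, add_mul]
  exact integral_add (integrable_mul_walsh hf t) (integrable_mul_walsh hg t)

lemma memLp_truncation (f : L2) (n : ℕ) :
    MemLp ((Iio (n : ℝ≥0)).indicator f) 2 lebesgue :=
  (Lp.memLp f).indicator measurableSet_Iio

lemma integrable_truncation (f : L2) (n : ℕ) :
    Integrable ((Iio (n : ℝ≥0)).indicator f) lebesgue := by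
  rw [integrable_indicator_iff measurableSet_Iio]
  have : IsFiniteMeasure (lebesgue.restrict (Iio (n : ℝ≥0))) :=
    isFiniteMeasure_restrict.2 (by rw [lebesgue_Iio]; exact ENNReal.coe_ne_top)
  exact ((Lp.memLp f).restrict _).integrable one_le_two

lemma memLp_walshFourier_truncation (f : L2) (n : ℕ) :
    MemLp (walshFourier ((Iio (n : ℝ≥0)).indicator f)) 2 lebesgue := by
  refine ⟨(measurable_walshFourier (integrable_truncation f n).1).aestronglyMeasurable, ?_⟩
  rw [eLpNorm_walshFourier (integrable_truncation f n)]
  exact (memLp_truncation f n).2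

lemma tendsto_toLp_truncation (f : L2) :
    Tendsto (fun n : ℕ => (memLp_truncation f n).toLp) atTop (𝓝 f) := by
  rw [Lp.tendsto_Lp_iff_tendsto_eLpNorm']
  have h1 : ∀ n : ℕ, eLpNorm (⇑(memLp_truncation f n).toLp - ⇑f) 2 lebesgue
      = (∫⁻ x, ‖(Iio (n : ℝ≥0)).indicator f x - f x‖ₑ ^ 2 ∂lebesgue) ^ (1 / 2 : ℝ) := by
    intro n
    have h2 : (⇑(memLp_truncation f n).toLp - ⇑f)
        =ᵐ[lebesgue] fun x => (Iio (n : ℝ≥0)).indicator f x - f x := by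
      filter_upwards [(memLp_truncation f n).coeFn_toLp] with x hx
      rw [Pi.sub_apply, hx]
    rw [eLpNorm_congr_ae h2, ← eLpNorm_two_sq, ← ENNReal.rpow_natCast, ← ENNReal.rpow_mul]
    norm_num
  simp_rw [h1]
  have h3 : Tendsto (fun n : ℕ => ∫⁻ x, ‖(Iio (n : ℝ≥0)).indicator f x - f x‖ₑ ^ 2 ∂lebesgue)
      atTop (𝓝 (∫⁻ _, 0 ∂lebesgue)) := by
    refine tendsto_lintegral_of_dominated_convergence' (fun x => ‖f x‖ₑ ^ 2) ?_ ?_ ?_ ?_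
    · exact fun n => ((memLp_truncation f n).1.sub (Lp.memLp f).1).enorm.pow_const 2
    · refine fun n => .of_forall fun x => ?_
      simp only
      by_cases hx : x ∈ Iio (n : ℝ≥0)
      · rw [indicator_of_mem hx]; simp
      · rw [indicator_of_notMem hx]; simp
    · rw [← eLpNorm_two_sq]
      exact ENNReal.pow_ne_top (Lp.eLpNorm_ne_top f)
    · refine .of_forall fun x => tendsto_const_nhds.congr' ?_
      obtain ⟨N, hN⟩ := exists_nat_gt x
      filter_upwards [eventually_ge_atTop N] with n hn
      have : x ∈ Iio (n : ℝ≥0) := hN.trans_le (by exact_mod_cast hn)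
      rw [indicator_of_mem this]; simp
  rw [lintegral_zero] at h3
  have h4 := ((ENNReal.continuous_rpow_const (y := (1 / 2 : ℝ))).tendsto 0).comp h3
  rwa [ENNReal.zero_rpow_of_pos (by norm_num)] at h4

lemma isWalshFourierL2_iff_tendsto_toLp {f g : L2} : IsWalshFourierL2 f g ↔
    Tendsto (fun n : ℕ => (memLp_walshFourier_truncation f n).toLp) atTop (𝓝 g) := by
  rw [IsWalshFourierL2, Lp.tendsto_Lp_iff_tendsto_eLpNorm']
  refine iff_of_eq (congrArg (fun u => Tendsto u atTop (𝓝 0)) (funext fun n => ?_))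
  refine eLpNorm_congr_ae ?_
  filter_upwards [(memLp_walshFourier_truncation f n).coeFn_toLp] with x hx
  rw [Pi.sub_apply, hx]

lemma edist_toLp_walshFourier_truncation (f : L2) (n m : ℕ) :
    edist (memLp_walshFourier_truncation f n).toLp (memLp_walshFourier_truncation f m).toLp
      = edist (memLp_truncation f n).toLp (memLp_truncation f m).toLp := by
  rw [Lp.edist_toLp_toLp, Lp.edist_toLp_toLp,
    ← walshFourier_sub (integrable_truncation f n) (integrable_truncation f m),
    eLpNorm_walshFourier ((integrable_truncation f n).sub (integrable_truncation f m))]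

/-- The transforms of the truncations form a Cauchy sequence by Plancherel's identity. -/
lemma exists_isWalshFourierL2 (f : L2) : ∃ g, IsWalshFourierL2 f g := by
  simp_rw [isWalshFourierL2_iff_tendsto_toLp]
  refine cauchySeq_tendsto_of_complete ?_
  have h := (tendsto_toLp_truncation f).cauchySeq
  rw [EMetric.cauchySeq_iff] at h ⊢
  simpa only [edist_toLp_walshFourier_truncation] using h

lemma isWalshFourierL2_walshFourierL2 (f : L2) : IsWalshFourierL2 f (walshFourierL2 f) :=
  Classical.epsilon_spec (exists_isWalshFourierL2 f)

lemma IsWalshFourierL2.norm_eq {f g : L2} (h : IsWalshFourierL2 f g) : ‖g‖ = ‖f‖ := by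
  have h1 := (isWalshFourierL2_iff_tendsto_toLp.1 h).norm
  have h2 := (tendsto_toLp_truncation f).norm
  refine tendsto_nhds_unique h1 (h2.congr fun n => ?_)
  rw [Lp.norm_toLp, Lp.norm_toLp, eLpNorm_walshFourier (integrable_truncation f n)]

lemma IsWalshFourierL2.eLpNorm_eq {f g : L2} (h : IsWalshFourierL2 f g) :
    eLpNorm g 2 lebesgue = eLpNorm f 2 lebesgue := by
  have := h.norm_eq
  rwa [Lp.norm_def, Lp.norm_def,
    ENNReal.toReal_eq_toReal_iff' (Lp.eLpNorm_ne_top g) (Lp.eLpNorm_ne_top f)] at this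

/-- Bounds for the transforms of all truncations pass to the limit. -/
lemma IsWalshFourierL2.eLpNorm_restrict_le {f g : L2} (h : IsWalshFourierL2 f g) {E : Set ℝ≥0}
    {c : ℝ≥0∞} (hc : ∀ n : ℕ, eLpNorm (walshFourier ((Iio (n : ℝ≥0)).indicator f)) 2
      (lebesgue.restrict E) ≤ c) : eLpNorm g 2 (lebesgue.restrict E) ≤ c := by
  have h1 : Tendsto (fun n : ℕ => c + eLpNorm
      (fun t => walshFourier ((Iio (n : ℝ≥0)).indicator f) t - g t) 2 lebesgue) atTop
      (𝓝 (c + 0)) := tendsto_const_nhds.add h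
  rw [add_zero] at h1
  refine ge_of_tendsto' h1 fun n => ?_
  have hT := (memLp_walshFourier_truncation f n).1
  have hg := (Lp.memLp g).1
  calc eLpNorm g 2 (lebesgue.restrict E)
      = eLpNorm (walshFourier ((Iio (n : ℝ≥0)).indicator f)
          - fun t => walshFourier ((Iio (n : ℝ≥0)).indicator f) t - g t) 2
          (lebesgue.restrict E) := by
        congr 1; funext t; simp
    _ ≤ _ := eLpNorm_sub_le hT.restrict (hT.sub hg).restrict one_le_two
    _ ≤ _ := add_le_add (hc n) (MeasureTheory.eLpNorm_restrict_le _ _ _ _)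

/-! ### The measure of dyadic balls -/

lemma mod_two_pow_eq_sum_bits (c M : ℕ) :
    c % 2 ^ M = ∑ k ∈ Finset.range M, c / 2 ^ k % 2 * 2 ^ k := by
  induction M with
  | zero => simp [Nat.mod_one]
  | succ M ih => rw [Finset.sum_range_succ, ← ih, Nat.mod_pow_succ, mul_comm]

lemma xor_div_two_pow_mod_two (a b k : ℕ) : (a ^^^ b) / 2 ^ k % 2
    = (((a / 2 ^ k % 2 : ℕ) : ℤ) - ((b / 2 ^ k % 2 : ℕ) : ℤ)).natAbs := by
  rw [Nat.xor_div_two_pow, Nat.xor_mod_two_eq]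
  lia

lemma natAbs_digit_sub_le_one (x y : ℝ≥0) (j : ℤ) :
    ((digit x j : ℤ) - (digit y j : ℤ)).natAbs ≤ 1 := by
  have := digit_lt_two x j
  have := digit_lt_two y j
  lia

lemma summable_dyadicAdd (x y : ℝ≥0) : Summable fun j : ℤ =>
    (((digit x j : ℤ) - (digit y j : ℤ)).natAbs : ℝ≥0) * (2 : ℝ≥0) ^ (-j - 1) := by
  obtain ⟨N, hN⟩ := exists_lt_two_pow (max x y)
  rw [← zpow_natCast] at hN
  have hi : Function.Injective fun k : ℕ => (k : ℤ) - N := fun a b hab => by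
    simp only at hab; lia
  rw [← hi.summable_iff]
  · refine NNReal.summable_of_le (f := fun k : ℕ => 2 ^ N * (1 / 2 : ℝ≥0) ^ k) (fun k => ?_) ?_
    · have h1 : (((digit x (k - N) : ℤ) - (digit y (k - N) : ℤ)).natAbs : ℝ≥0) ≤ 1 := by
        exact_mod_cast natAbs_digit_sub_le_one x y _
      calc _ ≤ 1 * (2 : ℝ≥0) ^ (-(k - N : ℤ) - 1) := by
            simp only [Function.comp_apply]; gcongr
        _ ≤ (2 : ℝ≥0) ^ (N - k : ℤ) := by
            rw [one_mul]
            exact zpow_le_zpow_right₀ one_le_two (by lia)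
        _ = _ := by
            rw [zpow_sub₀ two_ne_zero, zpow_natCast, zpow_natCast]
            simp [div_eq_mul_inv]
    · refine Summable.mul_left _ (NNReal.summable_geometric ?_)
      rw [one_div]; exact two_inv_lt_one
  · intro j hj
    have hjN : j < -N := by
      by_contra hc
      exact hj ⟨(j + N).toNat, by simp only; lia⟩
    rw [digit_eq_zero_of_lt ((le_max_left _ _).trans_lt hN) hjN,
      digit_eq_zero_of_lt ((le_max_right _ _).trans_lt hN) hjN]
    simp

/-- The exclusive or of the cell indices is a lower bound for the dyadic distance. -/
lemma floor_xor_floor_le (n : ℕ) (x y : ℝ≥0) :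
    ((⌊(2 : ℝ≥0) ^ n * x⌋₊ ^^^ ⌊(2 : ℝ≥0) ^ n * y⌋₊ : ℕ) : ℝ≥0) ≤ 2 ^ n * dyadicAdd x y := by
  set a := ⌊(2 : ℝ≥0) ^ n * x⌋₊ with ha
  set b := ⌊(2 : ℝ≥0) ^ n * y⌋₊ with hb
  obtain ⟨M, hM⟩ := pow_unbounded_of_one_lt (a ^^^ b) one_lt_two
  have hi : Function.Injective fun k : ℕ => (n : ℤ) - 1 - k := fun a b hab => by
    simp only at hab; lia
  have hd : ∀ z : ℝ≥0, ∀ k : ℕ, digit z (n - 1 - k) = ⌊(2 : ℝ≥0) ^ n * z⌋₊ / 2 ^ k % 2 :=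
    fun z k => by rw [digit_eq_floor_div, zpow_natCast]
  have h1 := (summable_dyadicAdd x y).sum_le_tsum
    ((Finset.range M).image fun k : ℕ => (n : ℤ) - 1 - k) (fun _ _ => zero_le)
  rw [Finset.sum_image hi.injOn] at h1
  refine le_trans (le_of_eq ?_) (mul_le_mul_right h1 _)
  rw [← Nat.mod_eq_of_lt hM, mod_two_pow_eq_sum_bits, Finset.mul_sum]
  push_cast
  refine Finset.sum_congr rfl fun k _ => ?_
  rw [xor_div_two_pow_mod_two, hd, hd, ← ha, ← hb]
  have : -((n : ℤ) - 1 - k) - 1 = k - n := by ring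
  rw [this, zpow_sub₀ two_ne_zero, zpow_natCast, zpow_natCast]
  field_simp

lemma measurable_dyadicAdd (y : ℝ≥0) : Measurable fun x => dyadicAdd x y := by
  refine Measurable.tsum fun j => Measurable.mul_const ?_ _
  exact (measurable_from_nat (f := fun n : ℕ => (((n : ℤ) - (digit y j : ℤ)).natAbs : ℝ≥0))).comp
    (measurable_digit j)

/-- A dyadic ball of radius `r` meets at most `⌈2^n r⌉` cells of length `2^{-n}`, as `a ↦ a xor b`
is injective. -/
lemma lebesgue_dyadicAdd_lt_le (y r : ℝ≥0) : lebesgue {x | dyadicAdd x y < r} ≤ r := by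
  have key : ∀ n : ℕ, lebesgue {x | dyadicAdd x y < r} ≤ r + ((1 / 2 : ℝ≥0) ^ n : ℝ≥0) := by
    intro n
    set b := ⌊(2 : ℝ≥0) ^ n * y⌋₊ with hb
    set S := (Finset.range ⌈(2 : ℝ≥0) ^ n * r⌉₊).image (· ^^^ b) with hS
    have hsub : {x | dyadicAdd x y < r} ⊆ ⋃ a ∈ S, {x : ℝ≥0 | ⌊(2 : ℝ≥0) ^ n * x⌋₊ = a} := by
      intro x hx
      simp only [mem_iUnion, mem_ofPred_eq, exists_prop, exists_eq_right']
      rw [hS, Finset.mem_image]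
      refine ⟨⌊(2 : ℝ≥0) ^ n * x⌋₊ ^^^ b, ?_, by rw [Nat.xor_xor_cancel_right]⟩
      rw [Finset.mem_range, Nat.lt_ceil]
      refine (floor_xor_floor_le n x y).trans_lt ?_
      have : dyadicAdd x y < r := hx
      gcongr
    have hcard : S.card ≤ ⌈(2 : ℝ≥0) ^ n * r⌉₊ :=
      Finset.card_image_le.trans (Finset.card_range _).le
    have hceil : ((⌈(2 : ℝ≥0) ^ n * r⌉₊ : ℕ) : ℝ≥0) * (2 ^ n)⁻¹ ≤ r + (1 / 2) ^ n := by
      calc _ ≤ (2 ^ n * r + 1) * (2 ^ n)⁻¹ := by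
            gcongr; exact (Nat.ceil_lt_add_one (by positivity)).le
        _ = _ := by
            rw [one_div, inv_pow]; field_simp
    calc _ ≤ _ := measure_mono hsub
      _ ≤ ∑ a ∈ S, lebesgue {x : ℝ≥0 | ⌊(2 : ℝ≥0) ^ n * x⌋₊ = a} := measure_biUnion_finset_le _ _
      _ = S.card * ((2 ^ n)⁻¹ : ℝ≥0∞) := by simp [lebesgue_floor_eq]
      _ ≤ (⌈(2 : ℝ≥0) ^ n * r⌉₊ : ℕ) * ((2 ^ n)⁻¹ : ℝ≥0∞) := by gcongr
      _ = (((⌈(2 : ℝ≥0) ^ n * r⌉₊ : ℕ) : ℝ≥0) * (2 ^ n)⁻¹ : ℝ≥0) := by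
          rw [ENNReal.coe_mul, ENNReal.coe_inv (by positivity)]; simp
      _ ≤ _ := by exact_mod_cast hceil
  have hlim : Tendsto (fun n : ℕ => (r : ℝ≥0∞) + ((1 / 2 : ℝ≥0) ^ n : ℝ≥0)) atTop (𝓝 (r + 0)) := by
    refine tendsto_const_nhds.add ?_
    rw [← ENNReal.coe_zero, ENNReal.tendsto_coe]
    exact tendsto_pow_atTop_nhds_zero_of_lt_one zero_le (by rw [one_div]; exact two_inv_lt_one)
  rw [add_zero] at hlim
  exact ge_of_tendsto' hlim key

lemma ae_dyadicAdd_ne_zero (y : ℝ≥0) : ∀ᵐ x ∂lebesgue, dyadicAdd x y ≠ 0 := by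
  rw [ae_iff]
  refine le_antisymm (ENNReal.le_of_forall_pos_le_add fun ε hε _ => ?_) zero_le
  rw [zero_add]
  refine (measure_mono fun x hx => ?_).trans (lebesgue_dyadicAdd_lt_le y ε)
  simp only [not_not, mem_ofPred_eq] at hx ⊢
  rwa [hx]

lemma setLIntegral_rpow_neg {α : ℝ} (hα : α < 1) (r : ℝ≥0) :
    ∫⁻ u in Ioo (0 : ℝ) r, ENNReal.ofReal (u ^ (-α))
      = ENNReal.ofReal ((r : ℝ) ^ (1 - α) / (1 - α)) := by
  have h1 : IntervalIntegrable (fun u : ℝ => u ^ (-α)) volume 0 r :=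
    intervalIntegral.intervalIntegrable_rpow' (by linarith)
  rw [intervalIntegrable_iff_integrableOn_Ioo_of_le r.coe_nonneg] at h1
  rw [← ofReal_integral_eq_lintegral_ofReal h1, ← integral_Ioc_eq_integral_Ioo,
    ← intervalIntegral.integral_of_le r.coe_nonneg, integral_rpow (Or.inl (by linarith))]
  · rw [Real.zero_rpow (by linarith), sub_zero]
    rw [neg_add_eq_sub]
  · filter_upwards [ae_restrict_mem measurableSet_Ioo] with u hu
    exact Real.rpow_nonneg hu.1.le _

/-- Comparison of distribution functions: if the sublevel sets `{d < s}` have measure at most `s`,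
then `∫_{d < r} d^{-α}` is at most `∫_0^r u^{-α} du`. -/
lemma setLIntegral_rpow_neg_le {X : Type*} [MeasurableSpace X] {μ : Measure X} {d : X → ℝ≥0}
    (hd : Measurable d) (hμ : ∀ s : ℝ≥0, μ {x | d x < s} ≤ s) {α : ℝ} (h0 : 0 < α) (h1 : α < 1)
    (r : ℝ≥0) : ∫⁻ x in {x | d x < r}, ENNReal.ofReal ((d x : ℝ) ^ (-α)) ∂μ
      ≤ ENNReal.ofReal ((r : ℝ) ^ (1 - α) / (1 - α)) := by
  have hA : MeasurableSet {x | d x < r} := hd measurableSet_Iio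
  have hmX : Measurable fun x => (d x : ℝ) ^ (-α) :=
    (hd.coe_nnreal_real).pow_const _
  have hmR : Measurable fun u : ℝ => u ^ (-α) := measurable_id.pow_const _
  rw [← setLIntegral_rpow_neg h1, ← lintegral_indicator hA, ← lintegral_indicator measurableSet_Ioo]
  have e1 : ∀ x, {x | d x < r}.indicator (fun x => ENNReal.ofReal ((d x : ℝ) ^ (-α))) x
      = ENNReal.ofReal ({x | d x < r}.indicator (fun x => (d x : ℝ) ^ (-α)) x) := by
    intro x; by_cases hx : x ∈ {x | d x < r} <;> simp [hx]
  have e2 : ∀ u, (Ioo (0 : ℝ) r).indicator (fun u => ENNReal.ofReal (u ^ (-α))) u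
      = ENNReal.ofReal ((Ioo (0 : ℝ) r).indicator (fun u => u ^ (-α)) u) := by
    intro u; by_cases hx : u ∈ Ioo (0 : ℝ) r <;> simp [hx]
  simp_rw [e1, e2]
  rw [lintegral_eq_lintegral_meas_lt, lintegral_eq_lintegral_meas_lt]
  · refine setLIntegral_mono' measurableSet_Ioi fun s (hs : 0 < s) => ?_
    set m : ℝ≥0 := min r (s ^ (-α)⁻¹).toNNReal with hm
    have hcoe : ((s ^ (-α)⁻¹).toNNReal : ℝ) = s ^ (-α)⁻¹ :=
      Real.coe_toNNReal _ (Real.rpow_nonneg hs.le _)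
    calc _ ≤ μ {x | d x < m} := by
          refine measure_mono fun x hx => ?_
          rw [mem_ofPred_eq] at hx ⊢
          by_cases hxr : d x < r
          · rw [indicator_of_mem (by exact hxr)] at hx
            have hx0 : (0 : ℝ) < d x := by
              rcases (d x).2.eq_or_lt with h | h
              · exfalso
                have h' : ((d x : ℝ≥0) : ℝ) = 0 := h.symm
                rw [h', Real.zero_rpow (by linarith)] at hx
                linarith
              · exact h
            refine lt_min hxr ?_
            rw [← NNReal.coe_lt_coe, hcoe]
            exact (Real.lt_rpow_inv_iff_of_neg hx0 hs (by linarith)).2 hx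
          · rw [indicator_of_notMem (by exact hxr)] at hx
            exact absurd hx hs.le.not_gt
      _ ≤ m := hμ m
      _ = volume (Ioo (0 : ℝ) m) := by rw [Real.volume_Ioo, sub_zero, ENNReal.ofReal_coe_nnreal]
      _ ≤ _ := by
          refine measure_mono fun u hu => ?_
          have hur : u < r := hu.2.trans_le (by exact_mod_cast min_le_left _ _)
          have hus : u < s ^ (-α)⁻¹ := by
            rw [← hcoe]
            exact hu.2.trans_le (by exact_mod_cast min_le_right _ _)
          rw [mem_ofPred_eq, indicator_of_mem (show u ∈ Ioo (0 : ℝ) r from ⟨hu.1, hur⟩)]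
          exact (Real.lt_rpow_inv_iff_of_neg hu.1 hs (by linarith)).1 hus
  · exact .of_forall fun u => indicator_nonneg (fun u hu => Real.rpow_nonneg hu.1.le _) u
  · exact (hmR.indicator measurableSet_Ioo).aemeasurable
  · exact .of_forall fun x => indicator_nonneg (fun x _ => Real.rpow_nonneg (d x).2 _) x
  · exact (hmX.indicator hA).aemeasurable

lemma setLIntegral_dyadicAdd_rpow_neg_le (y : ℝ≥0) {α : ℝ} (h0 : 0 < α) (h1 : α < 1) (r : ℝ≥0) :
    ∫⁻ x in {x | dyadicAdd x y < r}, (dyadicAdd x y : ℝ≥0∞) ^ (-α) ∂lebesgue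
      ≤ ENNReal.ofReal ((r : ℝ) ^ (1 - α) / (1 - α)) := by
  refine le_trans (le_of_eq (lintegral_congr_ae ?_)) (setLIntegral_rpow_neg_le
    (measurable_dyadicAdd y) (lebesgue_dyadicAdd_lt_le y) h0 h1 r)
  filter_upwards [ae_restrict_of_ae (ae_dyadicAdd_ne_zero y)] with x hx
  rw [← ENNReal.ofReal_rpow_of_pos (by positivity), ENNReal.ofReal_coe_nnreal]

/-! ### The local uncertainty principle -/

/-- The dispersion `∫ (x ⊕ y)^{2θ} |f(x)|² dx` of order `θ` around `y`. -/
noncomputable def dispersion (θ : ℝ) (y : ℝ≥0) (f : ℝ≥0 → ℂ) : ℝ≥0∞ :=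
  ∫⁻ x, (dyadicAdd x y : ℝ≥0∞) ^ (2 * θ) * ‖f x‖ₑ ^ 2 ∂lebesgue

lemma measurable_dyadicAdd_rpow (y : ℝ≥0) (α : ℝ) :
    Measurable fun x => (dyadicAdd x y : ℝ≥0∞) ^ α :=
  (measurable_dyadicAdd y).coe_nnreal_ennreal.pow_const _

lemma measurableSet_dyadicAdd_lt (y r : ℝ≥0) : MeasurableSet {x | dyadicAdd x y < r} :=
  measurable_dyadicAdd y measurableSet_Iio

lemma ennreal_sq_rpow_half (a : ℝ≥0∞) : (a ^ 2) ^ (1 / 2 : ℝ) = a := by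
  rw [← ENNReal.rpow_natCast, ← ENNReal.rpow_mul]; norm_num

lemma ennreal_rpow_half_sq (a : ℝ≥0∞) : (a ^ (1 / 2 : ℝ)) ^ 2 = a := by
  rw [← ENNReal.rpow_natCast, ← ENNReal.rpow_mul]; norm_num

lemma dispersion_mono {θ : ℝ} {y : ℝ≥0} {f g : ℝ≥0 → ℂ} (h : ∀ x, ‖f x‖ₑ ≤ ‖g x‖ₑ) :
    dispersion θ y f ≤ dispersion θ y g :=
  lintegral_mono fun x => by gcongr; exact h x

/-- The part of `f` near `y` is controlled in `L₁`, by the Cauchy-Schwarz inequality. -/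
lemma setLIntegral_enorm_le_dispersion {θ : ℝ} (h0 : 0 < θ) (h1 : θ < 1 / 2) (y r : ℝ≥0)
    {f : ℝ≥0 → ℂ} (hf : AEStronglyMeasurable f lebesgue) :
    ∫⁻ x in {x | dyadicAdd x y < r}, ‖f x‖ₑ ∂lebesgue
      ≤ ENNReal.ofReal ((r : ℝ) ^ (1 - 2 * θ) / (1 - 2 * θ)) ^ (1 / 2 : ℝ)
        * dispersion θ y f ^ (1 / 2 : ℝ) := by
  have hcs := ENNReal.lintegral_mul_norm_pow_le
    (μ := lebesgue.restrict {x | dyadicAdd x y < r})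
    (f := fun x => (dyadicAdd x y : ℝ≥0∞) ^ (-(2 * θ)))
    (g := fun x => (dyadicAdd x y : ℝ≥0∞) ^ (2 * θ) * ‖f x‖ₑ ^ 2)
    (measurable_dyadicAdd_rpow y _).aemeasurable
    ((measurable_dyadicAdd_rpow y _).aemeasurable.mul (hf.restrict.enorm.pow_const 2))
    (p := 1 / 2) (q := 1 / 2) (by norm_num) (by norm_num) (by norm_num)
  refine le_trans (le_of_eq (lintegral_congr_ae ?_)) (hcs.trans ?_)
  · filter_upwards [ae_restrict_of_ae (ae_dyadicAdd_ne_zero y)] with x hx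
    rw [ENNReal.mul_rpow_of_nonneg _ _ (by norm_num), ennreal_sq_rpow_half, ← mul_assoc,
      ← ENNReal.mul_rpow_of_nonneg _ _ (by norm_num),
      ← ENNReal.rpow_add _ _ (by exact_mod_cast hx) ENNReal.coe_ne_top, neg_add_cancel,
      ENNReal.rpow_zero, ENNReal.one_rpow, one_mul]
  · gcongr
    · exact setLIntegral_dyadicAdd_rpow_neg_le y (by linarith) (by linarith) r
    · exact setLIntegral_le_lintegral _ _

/-- The part of `f` away from `y` is controlled in `L₂`. -/
lemma setLIntegral_compl_enorm_sq_le_dispersion {θ : ℝ} (h0 : 0 < θ) (y : ℝ≥0) {r : ℝ≥0}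
    (hr : 0 < r) (f : ℝ≥0 → ℂ) :
    ∫⁻ x in {x | dyadicAdd x y < r}ᶜ, ‖f x‖ₑ ^ 2 ∂lebesgue
      ≤ (r : ℝ≥0∞) ^ (-(2 * θ)) * dispersion θ y f := by
  have hr0 : (r : ℝ≥0∞) ≠ 0 := by exact_mod_cast hr.ne'
  rw [dispersion, ← lintegral_const_mul' _ _ (by
    rw [ENNReal.rpow_neg]; exact ENNReal.inv_ne_top.2 (by
      rw [Ne, ENNReal.rpow_eq_zero_iff]; simp [hr0]))]
  refine le_trans (setLIntegral_mono' (measurableSet_dyadicAdd_lt y r).compl fun x hx => ?_)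
    (setLIntegral_le_lintegral _ _)
  have hx' : r ≤ dyadicAdd x y := not_lt.1 hx
  rw [← mul_assoc]
  refine le_mul_of_one_le_left zero_le ?_
  calc (1 : ℝ≥0∞) = (r : ℝ≥0∞) ^ (-(2 * θ)) * (r : ℝ≥0∞) ^ (2 * θ) := by
        rw [← ENNReal.rpow_add _ _ hr0 ENNReal.coe_ne_top]; simp
    _ ≤ _ := by gcongr

lemma enorm_walshFourier_le (f : ℝ≥0 → ℂ) (t : ℝ≥0) :
    ‖walshFourier f t‖ₑ ≤ ∫⁻ x, ‖f x‖ₑ ∂lebesgue := by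
  refine (enorm_integral_le_lintegral_enorm _).trans (le_of_eq (lintegral_congr fun x => ?_))
  rw [enorm_mul, enorm_complex_ofReal, ← ofReal_norm (walsh t x), norm_walsh]
  simp

lemma eLpNorm_two_eq {X : Type*} [MeasurableSpace X] (f : X → ℂ) (μ : Measure X) :
    eLpNorm f 2 μ = (∫⁻ x, ‖f x‖ₑ ^ 2 ∂μ) ^ (1 / 2 : ℝ) := by
  rw [← eLpNorm_two_sq, ennreal_sq_rpow_half]

lemma eLpNorm_restrict_walshFourier_le {θ : ℝ} (h0 : 0 < θ) (h1 : θ < 1 / 2) (y : ℝ≥0) {r : ℝ≥0}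
    (hr : 0 < r) {f : ℝ≥0 → ℂ} (hf : Integrable f lebesgue) {E : Set ℝ≥0} {R : ℝ≥0}
    (hE : lebesgue E ≤ R) :
    eLpNorm (walshFourier f) 2 (lebesgue.restrict E)
      ≤ ((R : ℝ≥0∞) ^ (1 / 2 : ℝ)
          * ENNReal.ofReal ((r : ℝ) ^ (1 - 2 * θ) / (1 - 2 * θ)) ^ (1 / 2 : ℝ)
          + (r : ℝ≥0∞) ^ (-θ)) * dispersion θ y f ^ (1 / 2 : ℝ) := by
  set A := {x | dyadicAdd x y < r} with hA
  have hAm : MeasurableSet A := measurableSet_dyadicAdd_lt y r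
  have hi1 := hf.indicator hAm
  have hi2 := hf.indicator hAm.compl
  have hsplit : walshFourier f = walshFourier (A.indicator f) + walshFourier (Aᶜ.indicator f) := by
    rw [← walshFourier_add hi1 hi2, indicator_self_add_compl]
  have near : eLpNorm (walshFourier (A.indicator f)) 2 (lebesgue.restrict E)
      ≤ (R : ℝ≥0∞) ^ (1 / 2 : ℝ)
        * (ENNReal.ofReal ((r : ℝ) ^ (1 - 2 * θ) / (1 - 2 * θ)) ^ (1 / 2 : ℝ)
          * dispersion θ y f ^ (1 / 2 : ℝ)) := by
    have h2 : ∫⁻ x, ‖A.indicator f x‖ₑ ∂lebesgue = ∫⁻ x in A, ‖f x‖ₑ ∂lebesgue := by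
      rw [← lintegral_indicator hAm]
      simp_rw [enorm_indicator_eq_indicator_enorm]
    calc eLpNorm (walshFourier (A.indicator f)) 2 (lebesgue.restrict E)
        ≤ (∫⁻ _ in E, (∫⁻ x in A, ‖f x‖ₑ ∂lebesgue) ^ 2 ∂lebesgue) ^ (1 / 2 : ℝ) := by
          rw [eLpNorm_two_eq]
          gcongr with t
          exact (enorm_walshFourier_le _ t).trans h2.le
      _ = (lebesgue E) ^ (1 / 2 : ℝ) * ∫⁻ x in A, ‖f x‖ₑ ∂lebesgue := by
          rw [setLIntegral_const, mul_comm, ENNReal.mul_rpow_of_nonneg _ _ (by norm_num),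
            ennreal_sq_rpow_half]
      _ ≤ _ := by
          gcongr
          exact setLIntegral_enorm_le_dispersion h0 h1 y r hf.1
  have far : eLpNorm (walshFourier (Aᶜ.indicator f)) 2 (lebesgue.restrict E)
      ≤ (r : ℝ≥0∞) ^ (-θ) * dispersion θ y f ^ (1 / 2 : ℝ) := by
    refine (eLpNorm_restrict_le _ _ _ _).trans ?_
    rw [eLpNorm_walshFourier hi2, eLpNorm_indicator_eq_eLpNorm_restrict hAm.compl, eLpNorm_two_eq]
    calc _ ≤ ((r : ℝ≥0∞) ^ (-(2 * θ)) * dispersion θ y f) ^ (1 / 2 : ℝ) := by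
          gcongr
          exact setLIntegral_compl_enorm_sq_le_dispersion h0 y hr f
      _ = _ := by
          rw [ENNReal.mul_rpow_of_nonneg _ _ (by norm_num), ← ENNReal.rpow_mul]
          congr 2; ring
  rw [hsplit]
  calc _ ≤ _ := eLpNorm_add_le (measurable_walshFourier hi1.1).aestronglyMeasurable
        (measurable_walshFourier hi2.1).aestronglyMeasurable one_le_two
    _ ≤ _ := add_le_add near far
    _ = _ := by ring

lemma K₁_nonneg {θ : ℝ} (h0 : 0 < θ) (h1 : θ < 1 / 2) : 0 ≤ K₁ θ :=
  mul_nonneg (Real.rpow_nonneg (by linarith) _) (Real.rpow_nonneg (by linarith) _)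

lemma K₁_pos {θ : ℝ} (h0 : 0 < θ) (h1 : θ < 1 / 2) : 0 < K₁ θ :=
  mul_pos (Real.rpow_pos_of_pos (by linarith) _) (Real.rpow_pos_of_pos (by linarith) _)

/-- The value of the bound at the radius `r = 4θ² / ((1 - 2θ) R)`, which minimizes it. -/
lemma local_bound_eq {θ : ℝ} (h0 : 0 < θ) (h1 : θ < 1 / 2) {R : ℝ} (hR : 0 < R) :
    R ^ (1 / 2 : ℝ) * (((2 * θ) ^ 2 / (1 - 2 * θ) / R) ^ (1 - 2 * θ) / (1 - 2 * θ)) ^ (1 / 2 : ℝ)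
      + ((2 * θ) ^ 2 / (1 - 2 * θ) / R) ^ (-θ) = K₁ θ * R ^ θ := by
  have hb : 0 < 1 - 2 * θ := by linarith
  set b := 1 - 2 * θ with hbdef
  have ha : 0 < 2 * θ := by linarith
  set a := 2 * θ with hadef
  clear_value b a
  have hr : 0 < a ^ 2 / b / R := by positivity
  have e1 : (a ^ 2 / b / R) ^ (-θ) = a ^ (-a) * b ^ θ * R ^ θ := by
    rw [Real.div_rpow (by positivity) hR.le, Real.div_rpow (by positivity) hb.le,
      ← Real.rpow_natCast, ← Real.rpow_mul ha.le, Real.rpow_neg hb.le, Real.rpow_neg hR.le]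
    have : ((2 : ℕ) : ℝ) * -θ = -a := by rw [hadef]; push_cast; ring
    rw [this]
    field_simp
  have e2 : R ^ (1 / 2 : ℝ) * ((a ^ 2 / b / R) ^ b / b) ^ (1 / 2 : ℝ)
      = (a ^ 2 / b / R) ^ (-θ) * (a / b) := by
    have h3 : (a ^ 2 / b / R) ^ b = (a ^ 2 / b / R) * (a ^ 2 / b / R) ^ (-a) := by
      rw [← Real.rpow_one_add' hr.le (by linarith), hbdef, sub_eq_add_neg]
    have h4 : R * ((a ^ 2 / b / R) ^ b / b) = ((a ^ 2 / b / R) ^ (-θ) * (a / b)) ^ 2 := by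
      have h5 : ((a ^ 2 / b / R) ^ (-θ)) ^ 2 = (a ^ 2 / b / R) ^ (-a) := by
        rw [← Real.rpow_natCast, ← Real.rpow_mul hr.le, hadef]
        congr 1; push_cast; ring
      rw [mul_pow ((a ^ 2 / b / R) ^ (-θ)), h5, h3]
      field_simp
    rw [← Real.mul_rpow hR.le (by positivity), h4, ← Real.sqrt_eq_rpow,
      Real.sqrt_sq (by positivity)]
  rw [e2, ← mul_add_one, e1, K₁, ← hadef, ← hbdef, Real.rpow_sub_one hb.ne']
  have : a / b + 1 = 1 / b := by
    rw [div_add_one hb.ne']; congr 1; rw [hbdef]; ring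
  rw [this]
  ring

/-- The local uncertainty principle: a function of small dispersion of order `θ` has a transform
with little mass in dyadic balls. -/
lemma setLIntegral_enorm_sq_le_dispersion {θ : ℝ} (h0 : 0 < θ) (h1 : θ < 1 / 2) (y s : ℝ≥0)
    {R : ℝ≥0} (hR : 0 < R) {f g : L2} (hfg : IsWalshFourierL2 f g) :
    ∫⁻ t in {t | dyadicAdd t s < R}, ‖g t‖ₑ ^ 2 ∂lebesgue
      ≤ ENNReal.ofReal ((K₁ θ * (R : ℝ) ^ θ) ^ 2) * dispersion θ y f := by
  have hb : 0 < 1 - 2 * θ := by linarith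
  have hR' : (0 : ℝ) < R := by exact_mod_cast hR
  have hr' : 0 < (2 * θ) ^ 2 / (1 - 2 * θ) / R := by positivity
  set r : ℝ≥0 := ⟨(2 * θ) ^ 2 / (1 - 2 * θ) / R, hr'.le⟩ with hrdef
  have hrc : (r : ℝ) = (2 * θ) ^ 2 / (1 - 2 * θ) / R := rfl
  have hr : 0 < r := by rw [← NNReal.coe_pos, hrc]; exact hr'
  have hconst : (R : ℝ≥0∞) ^ (1 / 2 : ℝ)
      * ENNReal.ofReal ((r : ℝ) ^ (1 - 2 * θ) / (1 - 2 * θ)) ^ (1 / 2 : ℝ) + (r : ℝ≥0∞) ^ (-θ)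
      = ENNReal.ofReal (K₁ θ * (R : ℝ) ^ θ) := by
    rw [← local_bound_eq h0 h1 hR', ← hrc, ← ENNReal.ofReal_coe_nnreal (p := R),
      ← ENNReal.ofReal_coe_nnreal (p := r), ENNReal.ofReal_rpow_of_nonneg hR'.le (by norm_num),
      ENNReal.ofReal_rpow_of_nonneg (by positivity) (by norm_num),
      ENNReal.ofReal_rpow_of_pos (by exact_mod_cast hr), ← ENNReal.ofReal_mul (by positivity),
      ← ENNReal.ofReal_add (by positivity) (by positivity)]
  have key : eLpNorm g 2 (lebesgue.restrict {t | dyadicAdd t s < R})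
      ≤ ENNReal.ofReal (K₁ θ * (R : ℝ) ^ θ) * dispersion θ y f ^ (1 / 2 : ℝ) := by
    refine hfg.eLpNorm_restrict_le fun n => ?_
    refine (eLpNorm_restrict_walshFourier_le h0 h1 y hr (integrable_truncation f n)
      (lebesgue_dyadicAdd_lt_le s R)).trans ?_
    rw [hconst]
    gcongr
    refine dispersion_mono fun x => ?_
    rw [enorm_indicator_eq_indicator_enorm]
    exact indicator_le_self _ _ _
  rw [← eLpNorm_two_sq]
  calc _ ≤ (ENNReal.ofReal (K₁ θ * (R : ℝ) ^ θ) * dispersion θ y f ^ (1 / 2 : ℝ)) ^ 2 := by gcongr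
    _ = _ := by
      rw [mul_pow, ennreal_rpow_half_sq, ENNReal.ofReal_pow]
      exact mul_nonneg (K₁_nonneg h0 h1) (by positivity)

/-! ### The uncertainty principle -/

/-- Hölder's inequality between the dispersions of order `0`, `θ` and `1`. -/
lemma dispersion_le_rpow_mul_rpow {θ : ℝ} (h0 : 0 < θ) (h1 : θ < 1) (y : ℝ≥0) {f : ℝ≥0 → ℂ}
    (hf : AEStronglyMeasurable f lebesgue) :
    dispersion θ y f ≤ dispersion 1 y f ^ θ * (∫⁻ x, ‖f x‖ₑ ^ 2 ∂lebesgue) ^ (1 - θ) := by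
  refine le_trans (le_of_eq (lintegral_congr fun x => ?_)) (ENNReal.lintegral_mul_norm_pow_le
    ((measurable_dyadicAdd_rpow y _).aemeasurable.mul (hf.enorm.pow_const 2))
    (hf.enorm.pow_const 2) h0.le (sub_nonneg.2 h1.le) (add_sub_cancel _ _))
  simp only [Pi.mul_apply]
  rw [ENNReal.mul_rpow_of_nonneg _ _ h0.le, mul_assoc,
    ← ENNReal.rpow_add_of_nonneg _ _ h0.le (sub_nonneg.2 h1.le), add_sub_cancel, ENNReal.rpow_one,
    ← ENNReal.rpow_mul, mul_one]

/-- By absolute continuity, `f` cannot be concentrated in small dyadic balls. This rules out the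
indeterminate product of a zero and an infinite variance. -/
lemma exists_pos_le_dispersion_one {f : ℝ≥0 → ℂ} (hf0 : ∫⁻ x, ‖f x‖ₑ ^ 2 ∂lebesgue ≠ 0)
    (hf : ∫⁻ x, ‖f x‖ₑ ^ 2 ∂lebesgue ≠ ∞) : ∃ c : ℝ≥0∞, c ≠ 0 ∧ ∀ y, c ≤ dispersion 1 y f := by
  set N := ∫⁻ x, ‖f x‖ₑ ^ 2 ∂lebesgue with hN
  obtain ⟨δ, hδ, h⟩ := exists_pos_setLIntegral_lt_of_measure_lt hf (ENNReal.half_pos hf0).ne'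
  obtain ⟨r, hr0, hrδ⟩ := ENNReal.lt_iff_exists_nnreal_btwn.1 hδ
  have hr : 0 < r := by exact_mod_cast hr0
  have hrt : (r : ℝ≥0∞) ^ (-(2 * 1 : ℝ)) ≠ ∞ := by
    rw [ENNReal.rpow_neg]
    refine ENNReal.inv_ne_top.2 ?_
    rw [Ne, ENNReal.rpow_eq_zero_iff]; simp [hr.ne']
  refine ⟨N / 2 / (r : ℝ≥0∞) ^ (-(2 * 1 : ℝ)), ?_, fun y => ENNReal.div_le_of_le_mul' ?_⟩
  · exact (ENNReal.div_pos (ENNReal.half_pos hf0).ne' hrt).ne'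
  · refine le_trans ?_ (setLIntegral_compl_enorm_sq_le_dispersion one_pos y hr f)
    have h2 := h _ ((lebesgue_dyadicAdd_lt_le y r).trans_lt hrδ)
    have h3 := lintegral_add_compl (μ := lebesgue) (fun x => ‖f x‖ₑ ^ 2)
      (measurableSet_dyadicAdd_lt y r)
    by_contra hc
    rw [not_le] at hc
    have h4 := ENNReal.add_lt_add h2 hc
    rw [h3, ENNReal.add_halves] at h4
    exact lt_irrefl _ h4

/-- The energy of the transform inside a ball is bounded by the local uncertainty principle, and
outside by the dispersion of the transform. -/
lemma lintegral_enorm_sq_le_dispersion_add {θ : ℝ} (h0 : 0 < θ) (h1 : θ < 1 / 2) (y s : ℝ≥0)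
    {R : ℝ≥0} (hR : 0 < R) {f g : L2} (hfg : IsWalshFourierL2 f g) :
    ∫⁻ t, ‖g t‖ₑ ^ 2 ∂lebesgue ≤ ENNReal.ofReal ((K₁ θ * (R : ℝ) ^ θ) ^ 2) * dispersion θ y f
      + (R : ℝ≥0∞) ^ (-(2 * θ)) * dispersion θ s g := by
  rw [← lintegral_add_compl _ (measurableSet_dyadicAdd_lt s R)]
  exact add_le_add (setLIntegral_enorm_sq_le_dispersion h0 h1 y s hR hfg)
    (setLIntegral_compl_enorm_sq_le_dispersion h0 s hR g)

lemma sq_le_four_mul_of_forall_pos {N a b : ℝ} (hN : 0 ≤ N) (ha : 0 ≤ a) (hb : 0 ≤ b)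
    (h : ∀ x, 0 < x → N ≤ a * x + b / x) : N ^ 2 ≤ 4 * a * b := by
  have := discrim_le_zero (a := a) (b := -N) (c := b) fun x => by
    rcases le_or_gt x 0 with hx | hx
    · nlinarith [mul_nonneg ha (mul_self_nonneg x), mul_nonneg hN (neg_nonneg.2 hx)]
    · have h2 := mul_le_mul_of_nonneg_right (h x hx) hx.le
      rw [add_mul, div_mul_cancel₀ _ hx.ne'] at h2
      linarith
  rw [discrim] at this
  linarith

lemma localConst_sq_mul_sq_le {θ N F G A B : ℝ} (h0 : 0 < θ) (h1 : θ < 1 / 2) (hN : 0 < N)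
    (hF : 0 ≤ F) (hG : 0 ≤ G) (hA0 : 0 ≤ A) (hA : A ≤ F ^ θ * N ^ (1 - θ))
    (hB : B ≤ G ^ θ * N ^ (1 - θ)) (h : N ^ 2 ≤ 4 * K₁ θ ^ 2 * A * B) :
    localConst θ ^ 2 * N ^ 2 ≤ F * G := by
  have hK : 0 < 2 * K₁ θ := mul_pos two_pos (K₁_pos h0 h1)
  have h2 : N ^ 2 ≤ (2 * K₁ θ) ^ 2 * (F * G) ^ θ * (N ^ (1 - θ)) ^ 2 := by
    calc N ^ 2 ≤ 4 * K₁ θ ^ 2 * A * B := h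
      _ ≤ 4 * K₁ θ ^ 2 * A * (G ^ θ * N ^ (1 - θ)) := by gcongr
      _ ≤ 4 * K₁ θ ^ 2 * (F ^ θ * N ^ (1 - θ)) * (G ^ θ * N ^ (1 - θ)) := by gcongr
      _ = _ := by rw [Real.mul_rpow hF hG]; ring
  have h3 : N ^ 2 = (N ^ 2) ^ θ * (N ^ (1 - θ)) ^ 2 := by
    rw [← Real.rpow_natCast N 2, ← Real.rpow_natCast (N ^ (1 - θ)) 2, ← Real.rpow_mul hN.le,
      ← Real.rpow_mul hN.le, ← Real.rpow_add hN]
    congr 1; push_cast; ring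
  rw [h3] at h2
  have h4 : (N ^ 2) ^ θ ≤ (2 * K₁ θ) ^ 2 * (F * G) ^ θ :=
    le_of_mul_le_mul_right h2 (by positivity)
  have h5 : localConst θ ^ 2 * N ^ 2 = (((2 * K₁ θ) ^ 2)⁻¹ * (N ^ 2) ^ θ) ^ θ⁻¹ := by
    rw [Real.mul_rpow (by positivity) (by positivity), Real.rpow_rpow_inv (by positivity) h0.ne',
      localConst, ← Real.rpow_natCast, ← Real.rpow_mul hK.le, Real.inv_rpow (by positivity),
      ← Real.rpow_natCast (2 * K₁ θ) 2, ← Real.rpow_mul hK.le, ← Real.rpow_neg hK.le]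
    congr 2
    push_cast; ring
  have h6 : F * G = ((F * G) ^ θ) ^ θ⁻¹ := (Real.rpow_rpow_inv (by positivity) h0.ne').symm
  rw [h5, h6]
  refine Real.rpow_le_rpow (by positivity) ?_ (inv_nonneg.2 h0.le)
  rwa [inv_mul_le_iff₀ (by positivity)]

lemma localConst_sq_mul_le_of_ne_top {θ : ℝ} (h0 : 0 < θ) (h1 : θ < 1 / 2) {f g : L2}
    (hfg : IsWalshFourierL2 f g) (hf : ∫⁻ x, ‖f x‖ₑ ^ 2 ∂lebesgue ≠ 0) {y s : ℝ≥0}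
    (hy : dispersion 1 y f ≠ ∞) (hs : dispersion 1 s g ≠ ∞) :
    ENNReal.ofReal (localConst θ ^ 2) * (∫⁻ x, ‖f x‖ₑ ^ 2 ∂lebesgue) ^ 2
      ≤ dispersion 1 y f * dispersion 1 s g := by
  have hNg : ∫⁻ t, ‖g t‖ₑ ^ 2 ∂lebesgue = ∫⁻ x, ‖f x‖ₑ ^ 2 ∂lebesgue := by
    rw [← eLpNorm_two_sq, ← eLpNorm_two_sq, hfg.eLpNorm_eq]
  have hNt : ∫⁻ x, ‖f x‖ₑ ^ 2 ∂lebesgue ≠ ∞ := by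
    rw [← eLpNorm_two_sq]; exact ENNReal.pow_ne_top (Lp.eLpNorm_ne_top f)
  have hA := dispersion_le_rpow_mul_rpow h0 (by linarith) y (Lp.memLp f).1
  have hB := dispersion_le_rpow_mul_rpow h0 (by linarith) s (Lp.memLp g).1
  rw [hNg] at hB
  have hI := fun (R : ℝ≥0) (hR : 0 < R) => lintegral_enorm_sq_le_dispersion_add h0 h1 y s hR hfg
  rw [hNg] at hI
  generalize (∫⁻ x, ‖f x‖ₑ ^ 2 ∂lebesgue) = N at *
  generalize dispersion 1 y f = F at *
  generalize dispersion 1 s g = G at *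
  generalize dispersion θ y f = A at *
  generalize dispersion θ s g = B at *
  have h1' : 0 ≤ 1 - θ := by linarith
  have hAt : A ≠ ∞ := ne_top_of_le_ne_top (ENNReal.mul_ne_top
    (ENNReal.rpow_ne_top_of_nonneg h0.le hy) (ENNReal.rpow_ne_top_of_nonneg h1' hNt)) hA
  have hBt : B ≠ ∞ := ne_top_of_le_ne_top (ENNReal.mul_ne_top
    (ENNReal.rpow_ne_top_of_nonneg h0.le hs) (ENNReal.rpow_ne_top_of_nonneg h1' hNt)) hB
  lift N to ℝ≥0 using hNt
  lift F to ℝ≥0 using hy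
  lift G to ℝ≥0 using hs
  lift A to ℝ≥0 using hAt
  lift B to ℝ≥0 using hBt
  rw [← ENNReal.coe_rpow_of_nonneg _ h0.le, ← ENNReal.coe_rpow_of_nonneg _ h1', ← ENNReal.coe_mul,
    ENNReal.coe_le_coe, ← NNReal.coe_le_coe] at hA hB
  push_cast at hA hB
  have hN : (0 : ℝ) < N := by
    rw [NNReal.coe_pos, pos_iff_ne_zero]; exact_mod_cast hf
  have key : (N : ℝ) ^ 2 ≤ 4 * (K₁ θ ^ 2 * A) * B := by
    refine sq_le_four_mul_of_forall_pos N.coe_nonneg (by positivity) B.coe_nonneg fun x hx => ?_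
    -- The radius is chosen so that `R^{2θ} = x`.
    have hRpos : 0 < x ^ (2 * θ)⁻¹ := by positivity
    set R : ℝ≥0 := ⟨x ^ (2 * θ)⁻¹, hRpos.le⟩ with hR
    have hRx : (R : ℝ) ^ (2 * θ) = x := Real.rpow_inv_rpow hx.le (by positivity)
    have hR0 : R ≠ 0 := fun h => hRpos.ne' (congrArg NNReal.toReal h)
    have h2 := hI R (pos_iff_ne_zero.2 hR0)
    rw [← ENNReal.coe_rpow_of_ne_zero hR0, ENNReal.ofReal, ← ENNReal.coe_mul, ← ENNReal.coe_mul,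
      ← ENNReal.coe_add, ENNReal.coe_le_coe, ← NNReal.coe_le_coe] at h2
    push_cast at h2
    rw [Real.coe_toNNReal _ (by positivity), mul_pow, ← Real.rpow_natCast ((R : ℝ) ^ θ),
      ← Real.rpow_mul R.coe_nonneg, Real.rpow_neg R.coe_nonneg, hRx] at h2
    have h3 : θ * ((2 : ℕ) : ℝ) = 2 * θ := by push_cast; ring
    rw [h3, hRx] at h2
    refine h2.trans (le_of_eq ?_)
    ring
  have hfin := localConst_sq_mul_sq_le h0 h1 hN F.coe_nonneg G.coe_nonneg A.coe_nonneg hA hB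
    (key.trans (le_of_eq (by ring)))
  rw [← ENNReal.coe_mul, ← ENNReal.coe_pow, ← ENNReal.ofReal_coe_nnreal (p := N ^ 2),
    ← ENNReal.ofReal_mul (sq_nonneg _), ← ENNReal.ofReal_coe_nnreal (p := F * G)]
  refine ENNReal.ofReal_le_ofReal ?_
  push_cast
  exact hfin

lemma le_iInf_mul_iInf_of_ne_zero {ι κ : Type*} {u : ι → ℝ≥0∞} {v : κ → ℝ≥0∞} {a : ℝ≥0∞}
    (hu : ⨅ i, u i ≠ 0) (hv : ⨅ j, v j ≠ 0) (h : ∀ i j, u i ≠ ∞ → v j ≠ ∞ → a ≤ u i * v j) :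
    a ≤ (⨅ i, u i) * ⨅ j, v j := by
  by_cases hui : ∃ i, u i ≠ ∞
  · by_cases hvj : ∃ j, v j ≠ ∞
    · refine ENNReal.le_iInf_mul_iInf hui hvj fun i j => ?_
      have hui0 : u i ≠ 0 := fun h0 => hu (le_antisymm (h0 ▸ iInf_le u i) zero_le)
      have hvj0 : v j ≠ 0 := fun h0 => hv (le_antisymm (h0 ▸ iInf_le v j) zero_le)
      by_cases hi : u i = ∞
      · rw [hi, ENNReal.top_mul hvj0]; exact le_top
      · by_cases hj : v j = ∞
        · rw [hj, ENNReal.mul_top hui0]; exact le_top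
        · exact h i j hi hj
    · push Not at hvj
      rw [iInf_eq_top.2 hvj, ENNReal.mul_top hu]; exact le_top
  · push Not at hui
    rw [iInf_eq_top.2 hui, ENNReal.top_mul hv]; exact le_top

lemma dyadicV_eq (f : L2) :
    dyadicV f = (⨅ y, dispersion 1 y f) / ∫⁻ x, ‖f x‖ₑ ^ 2 ∂lebesgue := by
  rw [dyadicV, eLpNorm_two_sq]
  congr 1
  refine iInf_congr fun y => lintegral_congr fun x => ?_
  rw [mul_one, ENNReal.rpow_ofNat]

lemma lintegral_enorm_sq_ne_zero {f : L2} (hf : f ≠ 0) : ∫⁻ x, ‖f x‖ₑ ^ 2 ∂lebesgue ≠ 0 := by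
  rw [← eLpNorm_two_sq]
  refine pow_ne_zero 2 fun h => hf ?_
  rw [← norm_eq_zero, Lp.norm_def, h, ENNReal.toReal_zero]

lemma iInf_dispersion_ne_zero {f : L2} (hf : f ≠ 0) : ⨅ y, dispersion 1 y f ≠ 0 := by
  obtain ⟨c, hc, h⟩ := exists_pos_le_dispersion_one (lintegral_enorm_sq_ne_zero hf) (by
    rw [← eLpNorm_two_sq]; exact ENNReal.pow_ne_top (Lp.eLpNorm_ne_top f))
  exact fun h0 => hc (le_antisymm ((le_iInf h).trans h0.le) zero_le)

lemma localConst_sq_le_dyadicUC {f : L2} (hf : f ≠ 0) {θ : ℝ} (h0 : 0 < θ) (h1 : θ < 1 / 2) :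
    ENNReal.ofReal (localConst θ ^ 2) ≤ dyadicUC f := by
  have hfg := isWalshFourierL2_walshFourierL2 f
  set g := walshFourierL2 f
  have hg : g ≠ 0 := by rwa [← norm_ne_zero_iff, hfg.norm_eq, norm_ne_zero_iff]
  have hN := lintegral_enorm_sq_ne_zero hf
  have hNt : ∫⁻ x, ‖f x‖ₑ ^ 2 ∂lebesgue ≠ ∞ := by
    rw [← eLpNorm_two_sq]; exact ENNReal.pow_ne_top (Lp.eLpNorm_ne_top f)
  have hNg : ∫⁻ t, ‖g t‖ₑ ^ 2 ∂lebesgue = ∫⁻ x, ‖f x‖ₑ ^ 2 ∂lebesgue := by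
    rw [← eLpNorm_two_sq, ← eLpNorm_two_sq, hfg.eLpNorm_eq]
  have key := le_iInf_mul_iInf_of_ne_zero (iInf_dispersion_ne_zero hf) (iInf_dispersion_ne_zero hg)
    fun y s hy hs => localConst_sq_mul_le_of_ne_top h0 h1 hfg hN hy hs
  rw [dyadicUC, dyadicV_eq, dyadicV_eq, hNg]
  rw [← ENNReal.le_div_iff_mul_le (Or.inl (pow_ne_zero 2 hN))
    (Or.inl (ENNReal.pow_ne_top hNt))] at key
  refine key.trans (le_of_eq ?_)
  rw [sq, div_eq_mul_inv, ENNReal.mul_inv (Or.inl hN) (Or.inl hNt), div_eq_mul_inv, div_eq_mul_inv]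
  ring

/-- The exponent `θ = 2/5` gives the constant `256 / 2500000 = 1.024 · 10⁻⁴`. -/
lemma localConst_two_fifths_sq : localConst (2 / 5) ^ 2 = 256 / 2500000 := by
  have hK : K₁ (2 / 5) ^ 5 = (4 / 5 : ℝ) ^ (-4 : ℤ) * (1 / 5 : ℝ) ^ (-3 : ℤ) := by
    rw [K₁, mul_pow, ← Real.rpow_natCast, ← Real.rpow_natCast, ← Real.rpow_mul (by norm_num),
      ← Real.rpow_mul (by norm_num), ← Real.rpow_intCast, ← Real.rpow_intCast]
    norm_num
  have hK0 : 0 ≤ 2 * K₁ (2 / 5) := mul_nonneg two_pos.le (K₁_nonneg (by norm_num) (by norm_num))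
  have h : localConst (2 / 5) ^ 2 = ((2 * K₁ (2 / 5)) ^ 5)⁻¹ := by
    rw [localConst, ← Real.rpow_natCast, ← Real.rpow_mul hK0, ← Real.rpow_natCast,
      ← Real.rpow_neg hK0]
    norm_num
  rw [h, mul_pow, hK]
  norm_num

end DyadicUncertainty

theorem theorem1 (f : DyadicUncertainty.L2) (hf : f ≠ 0) :
    DyadicUncertainty.IsWalshFourierL2 f (DyadicUncertainty.walshFourierL2 f) ∧
    (∀ θ : ℝ, 0 < θ → θ < 1 / 2 →
      ENNReal.ofReal (DyadicUncertainty.localConst θ ^ 2) ≤ DyadicUncertainty.dyadicUC f) ∧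
    ENNReal.ofReal (8.5 * (10 : ℝ) ^ (-5 : ℤ)) ≤ DyadicUncertainty.dyadicUC f := by
  refine ⟨DyadicUncertainty.isWalshFourierL2_walshFourierL2 f,
    fun θ h0 h1 => DyadicUncertainty.localConst_sq_le_dyadicUC hf h0 h1, ?_⟩
  refine le_trans (ENNReal.ofReal_le_ofReal ?_)
    (DyadicUncertainty.localConst_sq_le_dyadicUC hf (θ := 2 / 5) (by norm_num) (by norm_num))
  rw [DyadicUncertainty.localConst_two_fifths_sq]
  norm_num
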